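/- Let $n\ge 1$, let $p_1=2<p_2=3<\dots<p_n$ be the first $n$ primes, and for real $x\ge 1$ let $N(x)=N_{2,3,5,\dots,p_n}(x)$ be the number of $(q_1,\dots,q_n)\in\mathbb{N}_0^n$ with $p_1^{q_1}\cdots p_n^{q_n}\le x$. Let $\chi(x)=1$ if $x=p_1^{q_1}\cdots p_n^{q_n}$ for some $q_1,\dots,q_n\in\mathbb{N}_0$ and $\chi(x)=0$ otherwise, and let $B_1^*(\{y\})=\{y\}-\tfrac12$ for $y\in\mathbb{R}\setminus\mathbb{Z}$ and $B_1^*(\{y\})=0$ for $y\in\mathbb{Z}$. Then for every real $x\ge 1$ $$N(x)=\operatorname{Res}_{s=0}\left(\frac{x^s}{s\prod_{k=1}^n\left(1-p_k^{-s}\right)}\right)-\frac{1}{2^{n-1}}\sum_{k=1}^n B_1^*\left(\left\{\frac{\log x}{\log p_k}\right\}\right)+\frac{1}{2^{n-1}\pi}\,L(x)+\frac12\chi(x),$$ where $$L(x)=\sum_{m=1}^n\sum_{r=1}^{n-1}\ \sum_{\substack{i_1<\dots<i_r\\ \{i_1,\dots,i_r\}\subset\{p_1,\dots,p_n\}\setminus\{p_m\}}}\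 \sum_{k=1}^\infty\frac{\sin\left(2\pi k\frac{\log x}{\log p_m}-\frac{\pi r}{2}\right)}{k}\prod_{l=1}^r\cot\left(\frac{\pi k\log i_l}{\log p_m}\right).$$ Here the series are to be interpreted together, as $$L(x)=\lim_{R\to\infty}\ \sum_{m=1}^n\sum_{r=1}^{n-1}\ \sum_{\substack{i_1<\dots<i_r\\ \{i_1,\dots,i_r\}\subset\{p_1,\dots,p_n\}\setminus\{p_m\}}}\ \sum_{k=1}^{\lfloor R\log p_m\rfloor}\frac{\sin\left(2\pi k\frac{\log x}{\log p_m}-\frac{\pi r}{2}\right)}{k}\prod_{l=1}^r\cot\left(\frac{\pi k\log i_l}{\log p_m}\right),$$ where $R\to\infty$ in an appropriate manner, namely through any sequence $R_j\to\infty$ for which there is a $\delta>0$ such that $|R_j\log p_k-\nu|\ge\delta$ for all $j$, all $1\le k\le n$ and all $\nu\in\mathbb{Z}$. Such sequences exist, and for each $x\ge1$ the limit exists along each of them and does not depend on the choice. -/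

import Mathlib

open Filter Topology

noncomputable section

/-- `p_1, …, p_n`: the first `n` primes, indexed by `Fin n` (so `firstPrimes n 0 = 2`). -/
def firstPrimes (n : ℕ) (k : Fin n) : ℕ := Nat.nth Nat.Prime k

/-- `a_1^{q_1} ⋯ a_n^{q_n}`. -/
def powerProduct {n : ℕ} (a : Fin n → ℕ) (q : Fin n → ℕ) : ℕ := ∏ k, a k ^ q k

/-- `N_{a_1,…,a_n}(x)`: the number of exponent vectors `q ∈ ℕ^n` with
`a_1^{q_1} ⋯ a_n^{q_n} ≤ x`. -/
def countProducts {n : ℕ} (a : Fin n → ℕ) (x : ℝ) : ℕ :=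
  Set.ncard {q : Fin n → ℕ | (powerProduct a q : ℝ) ≤ x}

/-- `S_{a_1,…,a_n}`, as a set of real numbers. -/
def productSet {n : ℕ} (a : Fin n → ℕ) : Set ℝ :=
  Set.range fun q : Fin n → ℕ => (powerProduct a q : ℝ)

/-- The characteristic function of `S_{a_1,…,a_n}`. -/
def productChi {n : ℕ} (a : Fin n → ℕ) (x : ℝ) : ℝ :=
  (productSet a).indicator (fun _ => 1) x

open Classical in
/-- `B₁^*({y})`: equal to `{y} - 1/2` if `y ∉ ℤ` and to `0` if `y ∈ ℤ`. -/
def bernoulliStar (y : ℝ) : ℝ :=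
  if y ∈ Set.range ((↑) : ℤ → ℝ) then 0 else Int.fract y - 1 / 2

/-- The residue at `z₀` of a function that is holomorphic in a punctured neighbourhood of `z₀`:
`(2πi)⁻¹ ∮_{|z - z₀| = r} f(z) dz` for all small `r > 0` (it does not depend on `r` then). -/
def residue (f : ℂ → ℂ) (z₀ : ℂ) : ℂ :=
  limUnder (𝓝[>] (0 : ℝ)) fun r : ℝ => (2 * Real.pi * Complex.I)⁻¹ * ∮ z in C(z₀, r), f z

/-- `x^s / (s ∏_k (1 - 1 / a_k^s))`. -/
def perronIntegrand {n : ℕ} (a : Fin n → ℕ) (x : ℝ) (s : ℂ) : ℂ :=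
  (x : ℂ) ^ s / (s * ∏ k, (1 - 1 / (a k : ℂ) ^ s))

/-- The `k`-th term of the series that belongs to `m` and to the index set
`I = {i_1, …, i_r} ∌ m`. -/
def cotangentTerm {n : ℕ} (a : Fin n → ℕ) (x : ℝ) (m : Fin n) (I : Finset (Fin n)) (k : ℕ) : ℝ :=
  Real.sin (2 * Real.pi * k * (Real.log x / Real.log (a m)) - Real.pi * I.card / 2) / k *
    ∏ l ∈ I, Real.cot (Real.pi * k * Real.log (a l) / Real.log (a m))

/-- The sum over `m`, over `r = 1, …, n - 1` and over all `r`-element index sets not containing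
`m` of the series truncated at `⌊R log a_m⌋`, with one common parameter `R`. -/
def cotangentSum {n : ℕ} (a : Fin n → ℕ) (x R : ℝ) : ℝ :=
  ∑ m : Fin n, ∑ r ∈ Finset.Icc 1 (n - 1),
    ∑ I ∈ Finset.powersetCard r (Finset.univ.erase m),
      ∑ k ∈ Finset.Icc 1 ⌊R * Real.log (a m)⌋₊, cotangentTerm a x m I k

/-- `R → ∞` in an appropriate manner: all the numbers `R_j log a_k` keep a distance `≥ δ > 0` from
the integers, that is, the lines `Im s = ±2πR_j` avoid the poles `2πiν / log a_k` by a margin. -/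
def AppropriateCutoffs {n : ℕ} (a : Fin n → ℕ) (R : ℕ → ℝ) : Prop :=
  Tendsto R atTop atTop ∧
    ∃ δ : ℝ, 0 < δ ∧ ∀ (j : ℕ) (k : Fin n) (ν : ℤ), δ ≤ |R j * Real.log (a k) - ν|

end

/-!
By the Euler product `∏ₖ (1 - aₖ⁻ˢ)⁻¹ = ∑_q (powerProduct a q)⁻ˢ` and Perron's formula, `N - χ/2` is
the principal value of `(2πi)⁻¹ ∫ F(s) ds` over `Re s = 1`, where `F(s) = xˢ / (s ∏ₖ (1 - aₖ⁻ˢ))`.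
Up to sign, the substitution `s ↦ -s` turns `x` into `(x ∏ₖ aₖ)⁻¹ < 1`, for which `N` and `χ`
vanish, so the integral over `Re s = -1` is zero. At the heights `±2πRⱼ` the factors `1 - aₖ⁻ˢ` are
bounded below, so the horizontal segments contribute nothing in the limit, and `N - χ/2` is the
limit of the sum of the residues of `F` at the poles `2πiν / log aₘ` between them.

Besides the residue at `0` these come in conjugate pairs. Since
`(1 - exp (-2iθ))⁻¹ = (1 - i cot θ) / 2`, multiplying out the product over `l ≠ m` gives one term
for each set of indices `l`: the nonempty sets yield the cotangent sum, and the empty set yields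
the Fourier series `∑ sin (2πky) / k = -π B₁*({y})` at `y = log x / log aₘ`.
-/

open Complex (I)
open MeasureTheory (volume)
open scoped Real

/-! ### Integrals over the boundary of a rectangle -/

section Rectangle

/-- The integral of `f` over the positively oriented boundary of the rectangle with lower left
corner `z` and upper right corner `w`, written side by side as in
`Complex.integral_boundary_rect_eq_zero_of_differentiableOn`. -/
noncomputable def rectIntegral (f : ℂ → ℂ) (z w : ℂ) : ℂ :=
  (∫ x : ℝ in z.re..w.re, f (x + z.im * I)) - (∫ x : ℝ in z.re..w.re, f (x + w.im * I)) +
    I * (∫ y : ℝ in z.im..w.im, f (w.re + y * I)) - I * (∫ y : ℝ in z.im..w.im, f (z.re + y * I))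

/-- The open rectangle with lower left corner `z` and upper right corner `w`. -/
def openRect (z w : ℂ) : Set ℂ := Set.Ioo z.re w.re ×ℂ Set.Ioo z.im w.im

/-- The closed rectangle with lower left corner `z` and upper right corner `w`. -/
def closedRect (z w : ℂ) : Set ℂ := Set.Icc z.re w.re ×ℂ Set.Icc z.im w.im

/-- The boundary of the rectangle with lower left corner `z` and upper right corner `w`. -/
def rectBoundary (z w : ℂ) : Set ℂ := closedRect z w \ openRect z w

variable {f g F : ℂ → ℂ} {z w p s : ℂ}

lemma re_le_re_of_mem_openRect (hp : p ∈ openRect z w) : z.re ≤ w.re := (hp.1.1.trans hp.1.2).le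

lemma im_le_im_of_mem_openRect (hp : p ∈ openRect z w) : z.im ≤ w.im := (hp.2.1.trans hp.2.2).le

lemma ne_of_mem_rectBoundary (hp : p ∈ openRect z w) (hs : s ∈ rectBoundary z w) : s ≠ p := by
  rintro rfl
  exact hs.2 hp

lemma horizontal_mem_rectBoundary (hre : z.re ≤ w.re) (him : z.im ≤ w.im) {x y : ℝ}
    (hx : x ∈ Set.uIcc z.re w.re) (hy : y = z.im ∨ y = w.im) :
    (x + y * I : ℂ) ∈ rectBoundary z w := by
  rw [Set.uIcc_of_le hre] at hx
  rcases hy with rfl | rfl <;>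
    exact ⟨by simpa [closedRect, Complex.mem_reProdIm, him] using hx,
      by simp [openRect, Complex.mem_reProdIm]⟩

lemma vertical_mem_rectBoundary (hre : z.re ≤ w.re) (him : z.im ≤ w.im) {x y : ℝ}
    (hx : x = z.re ∨ x = w.re) (hy : y ∈ Set.uIcc z.im w.im) :
    (x + y * I : ℂ) ∈ rectBoundary z w := by
  rw [Set.uIcc_of_le him] at hy
  rcases hx with rfl | rfl <;>
    exact ⟨by simpa [closedRect, Complex.mem_reProdIm, hre] using hy,
      by simp [openRect, Complex.mem_reProdIm]⟩

lemma rectIntegral_congr (hre : z.re ≤ w.re) (him : z.im ≤ w.im)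
    (h : Set.EqOn f g (rectBoundary z w)) : rectIntegral f z w = rectIntegral g z w := by
  have horizontal (y : ℝ) (hy : y = z.im ∨ y = w.im) :
      (∫ x : ℝ in z.re..w.re, f (x + y * I)) = ∫ x : ℝ in z.re..w.re, g (x + y * I) :=
    intervalIntegral.integral_congr fun x hx => h (horizontal_mem_rectBoundary hre him hx hy)
  have vertical (x : ℝ) (hx : x = z.re ∨ x = w.re) :
      (∫ y : ℝ in z.im..w.im, f (x + y * I)) = ∫ y : ℝ in z.im..w.im, g (x + y * I) :=
    intervalIntegral.integral_congr fun y hy => h (vertical_mem_rectBoundary hre him hx hy)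
  simp only [rectIntegral, horizontal _ (.inl rfl), horizontal _ (.inr rfl),
    vertical _ (.inl rfl), vertical _ (.inr rfl)]

lemma intervalIntegrable_horizontal (hre : z.re ≤ w.re) (him : z.im ≤ w.im)
    (hf : ContinuousOn f (rectBoundary z w)) {y : ℝ} (hy : y = z.im ∨ y = w.im) :
    IntervalIntegrable (fun x : ℝ => f (x + y * I)) volume z.re w.re :=
  (hf.comp (by fun_prop)
    fun _ hx => horizontal_mem_rectBoundary hre him hx hy).intervalIntegrable

lemma intervalIntegrable_vertical (hre : z.re ≤ w.re) (him : z.im ≤ w.im)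
    (hf : ContinuousOn f (rectBoundary z w)) {x : ℝ} (hx : x = z.re ∨ x = w.re) :
    IntervalIntegrable (fun y : ℝ => f (x + y * I)) volume z.im w.im :=
  (hf.comp (by fun_prop) fun _ hy => vertical_mem_rectBoundary hre him hx hy).intervalIntegrable

lemma rectIntegral_add (hre : z.re ≤ w.re) (him : z.im ≤ w.im)
    (hf : ContinuousOn f (rectBoundary z w)) (hg : ContinuousOn g (rectBoundary z w)) :
    rectIntegral (fun s => f s + g s) z w = rectIntegral f z w + rectIntegral g z w := by
  have horizontal (y : ℝ) (hy : y = z.im ∨ y = w.im) :=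
    intervalIntegral.integral_add (intervalIntegrable_horizontal hre him hf hy)
      (intervalIntegrable_horizontal hre him hg hy)
  have vertical (x : ℝ) (hx : x = z.re ∨ x = w.re) :=
    intervalIntegral.integral_add (intervalIntegrable_vertical hre him hf hx)
      (intervalIntegrable_vertical hre him hg hx)
  simp only [rectIntegral, horizontal _ (.inl rfl), horizontal _ (.inr rfl),
    vertical _ (.inl rfl), vertical _ (.inr rfl)]
  ring

lemma rectIntegral_const_mul (c : ℂ) :
    rectIntegral (fun s => c * f s) z w = c * rectIntegral f z w := by
  simp only [rectIntegral, intervalIntegral.integral_const_mul]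
  ring

lemma rectIntegral_sum {ι : Type*} (S : Finset ι) (f : ι → ℂ → ℂ) (hre : z.re ≤ w.re)
    (him : z.im ≤ w.im) (hf : ∀ i ∈ S, ContinuousOn (f i) (rectBoundary z w)) :
    rectIntegral (fun s => ∑ i ∈ S, f i s) z w = ∑ i ∈ S, rectIntegral (f i) z w := by
  classical
  induction S using Finset.induction_on with
  | empty => simp [rectIntegral]
  | insert i S hi ih =>
    rw [Finset.forall_mem_insert] at hf
    simp only [Finset.sum_insert hi]
    rw [rectIntegral_add hre him hf.1 (continuousOn_finsetSum S hf.2), ih hf.2]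

lemma rectIntegral_eq_zero_of_differentiableAt (hre : z.re ≤ w.re) (him : z.im ≤ w.im)
    (hf : ∀ s ∈ closedRect z w, DifferentiableAt ℂ f s) : rectIntegral f z w = 0 := by
  rw [closedRect, ← Set.uIcc_of_le hre, ← Set.uIcc_of_le him] at hf
  exact Complex.integral_boundary_rect_eq_zero_of_differentiableOn f z w
    fun s hs => (hf s hs).differentiableWithinAt

lemma integral_horizontal_eq_sub {a b y : ℝ}
    (hF : ∀ x ∈ Set.uIcc a b, HasDerivAt F (f (x + y * I)) (x + y * I))
    (hf : IntervalIntegrable (fun x : ℝ => f (x + y * I)) volume a b) :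
    ∫ x : ℝ in a..b, f (x + y * I) = F (b + y * I) - F (a + y * I) := by
  refine intervalIntegral.integral_eq_sub_of_hasDerivAt (f := fun x : ℝ => F (x + y * I))
    (fun x hx => ?_) hf
  have hline : HasDerivAt (fun x : ℝ => (x : ℂ) + y * I) 1 x :=
    (Complex.ofRealCLM.hasDerivAt (x := x)).add_const _
  simpa [Function.comp_def] using (hF x hx).comp x hline

lemma integral_vertical_eq_sub {a b x : ℝ}
    (hF : ∀ y ∈ Set.uIcc a b, HasDerivAt F (f (x + y * I)) (x + y * I))
    (hf : IntervalIntegrable (fun y : ℝ => f (x + y * I)) volume a b) :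
    I * ∫ y : ℝ in a..b, f (x + y * I) = F (x + b * I) - F (x + a * I) := by
  rw [← intervalIntegral.integral_const_mul]
  refine intervalIntegral.integral_eq_sub_of_hasDerivAt (f := fun y : ℝ => F (x + y * I))
    (fun y hy => ?_) (hf.const_mul _)
  have hline : HasDerivAt (fun y : ℝ => (x : ℂ) + y * I) I y := by
    simpa using ((Complex.ofRealCLM.hasDerivAt (x := y)).mul_const I).const_add (x : ℂ)
  simpa [Function.comp_def, mul_comm] using (hF y hy).comp y hline

lemma rectIntegral_eq_zero_of_hasDerivAt (hre : z.re ≤ w.re) (him : z.im ≤ w.im)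
    (hf : ContinuousOn f (rectBoundary z w))
    (hF : ∀ s ∈ rectBoundary z w, HasDerivAt F (f s) s) : rectIntegral f z w = 0 := by
  have horizontal (y : ℝ) (hy : y = z.im ∨ y = w.im) :=
    integral_horizontal_eq_sub (fun x hx => hF _ (horizontal_mem_rectBoundary hre him hx hy))
      (intervalIntegrable_horizontal hre him hf hy)
  have vertical (x : ℝ) (hx : x = z.re ∨ x = w.re) :=
    integral_vertical_eq_sub (fun y hy => hF _ (vertical_mem_rectBoundary hre him hx hy))
      (intervalIntegrable_vertical hre him hf hx)
  rw [rectIntegral, horizontal _ (.inl rfl), horizontal _ (.inr rfl), vertical _ (.inl rfl),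
    vertical _ (.inr rfl)]
  ring

lemma continuousOn_sub_zpow_rectBoundary (hp : p ∈ openRect z w) (m : ℤ) :
    ContinuousOn (fun s => (s - p) ^ m) (rectBoundary z w) := fun _ hs =>
  ((continuousAt_id.sub continuousAt_const).zpow₀ m
    (.inl (sub_ne_zero.2 (ne_of_mem_rectBoundary hp hs)))).continuousWithinAt

lemma hasDerivAt_sub_zpow_div {m : ℤ} (hm : m ≠ -1) (hs : s ≠ p) :
    HasDerivAt (fun s => (s - p) ^ (m + 1) / (m + 1)) ((s - p) ^ m) s := by
  have hm' : (m : ℂ) + 1 ≠ 0 := mod_cast fun h : m + 1 = 0 => hm (by lia)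
  have h := ((hasDerivAt_zpow (m + 1) (s - p) (.inl (sub_ne_zero.2 hs))).comp s
    ((hasDerivAt_id s).sub_const p)).div_const ((m : ℂ) + 1)
  refine h.congr_deriv ?_
  push_cast
  rw [add_sub_cancel_right, mul_one, mul_div_cancel_left₀ _ hm']

lemma rectIntegral_sub_zpow (hp : p ∈ openRect z w) {m : ℤ} (hm : m ≠ -1) :
    rectIntegral (fun s => (s - p) ^ m) z w = 0 :=
  rectIntegral_eq_zero_of_hasDerivAt (re_le_re_of_mem_openRect hp) (im_le_im_of_mem_openRect hp)
    (continuousOn_sub_zpow_rectBoundary hp m)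
    fun _ hs => hasDerivAt_sub_zpow_div hm (ne_of_mem_rectBoundary hp hs)

lemma hasDerivAt_log_mul_sub {u : ℂ} (hu : u ≠ 0) (hs : 0 < (u * (s - p)).re) :
    HasDerivAt (fun s => Complex.log (u * (s - p))) (s - p)⁻¹ s := by
  have hlin : HasDerivAt (fun s => u * (s - p)) u s := by
    simpa using ((hasDerivAt_id s).sub_const p).const_mul u
  simpa [div_mul_eq_div_div, hu] using hlin.clog (.inl hs)

lemma log_sub_log_neg_I_mul {v : ℂ} (hre : 0 < v.re) (him : 0 < v.im) :
    Complex.log v - Complex.log (-I * v) = I * (π / 2) := by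
  have hv : v ≠ 0 := by rintro rfl; simp at hre
  have harg : -I.arg + v.arg ∈ Set.Ioc (-π) π := by
    have h0 := Complex.arg_nonneg_iff.2 him.le
    have hpi := Complex.arg_le_pi v
    rw [Complex.arg_I]
    constructor <;> linarith [Real.pi_pos]
  rw [Complex.log_mul (by simp) hv (by simpa using harg), Complex.log_neg_I]
  ring

/-- Each side is integrated with the branch of the logarithm of `s - p` whose cut is opposite to it;
at every corner the two branches differ by `iπ/2`. -/
lemma rectIntegral_sub_inv (hp : p ∈ openRect z w) :
    rectIntegral (fun s => (s - p)⁻¹) z w = 2 * π * I := by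
  have hre := re_le_re_of_mem_openRect hp
  have him := im_le_im_of_mem_openRect hp
  have hc : ContinuousOn (fun s => (s - p)⁻¹) (rectBoundary z w) := by
    simpa using continuousOn_sub_zpow_rectBoundary hp (-1)
  obtain ⟨⟨hz1, hw1⟩, ⟨hz2, hw2⟩⟩ := hp
  rw [rectIntegral,
    integral_horizontal_eq_sub (f := fun s => (s - p)⁻¹)
      (fun x _ => hasDerivAt_log_mul_sub Complex.I_ne_zero (by simpa using hz2))
      (intervalIntegrable_horizontal hre him hc (.inl rfl)),
    integral_horizontal_eq_sub (f := fun s => (s - p)⁻¹)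
      (fun x _ => hasDerivAt_log_mul_sub (neg_ne_zero.2 Complex.I_ne_zero) (by simpa using hw2))
      (intervalIntegrable_horizontal hre him hc (.inr rfl)),
    integral_vertical_eq_sub (f := fun s => (s - p)⁻¹)
      (fun y _ => hasDerivAt_log_mul_sub (u := 1) one_ne_zero (by simpa using hw1))
      (intervalIntegrable_vertical hre him hc (.inr rfl)),
    integral_vertical_eq_sub (f := fun s => (s - p)⁻¹)
      (fun y _ => hasDerivAt_log_mul_sub (u := -1) (by simp) (by simpa using hz1))
      (intervalIntegrable_vertical hre him hc (.inl rfl))]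
  have top_right := log_sub_log_neg_I_mul (v := 1 * (w.re + w.im * I - p))
    (by simpa using hw1) (by simpa using hw2)
  have top_left := log_sub_log_neg_I_mul (v := -I * (z.re + w.im * I - p))
    (by simpa using hw2) (by simpa using hz1)
  have bottom_left := log_sub_log_neg_I_mul (v := -1 * (z.re + z.im * I - p))
    (by simpa using hz1) (by simpa using hz2)
  have bottom_right := log_sub_log_neg_I_mul (v := I * (w.re + z.im * I - p))
    (by simpa using hz2) (by simpa using hw1)
  rw [← mul_assoc, show -I * 1 = -I by ring] at top_right
  rw [← mul_assoc, show -I * -I = -1 by simp] at top_left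
  rw [← mul_assoc, show -I * -1 = I by ring] at bottom_left
  rw [← mul_assoc, show -I * I = 1 by simp] at bottom_right
  linear_combination top_right + top_left + bottom_left + bottom_right

end Rectangle

/-! ### Residues -/

section Residue

lemma analyticAt_dslope {𝕜 E : Type*} [NontriviallyNormedField 𝕜] [NormedAddCommGroup E]
    [NormedSpace 𝕜 E] {f : 𝕜 → E} {a : 𝕜} (hf : AnalyticAt 𝕜 f a) :
    AnalyticAt 𝕜 (dslope f a) a :=
  let ⟨_, hq⟩ := hf
  hq.has_fpower_series_dslope_fslope.analyticAt

/-- The principal part `∑_{j < N} c_j (s - p)^{-j-1}` of a Laurent expansion at `p`. The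
coefficients are indexed by the order of the pole minus one, so that `c 0` is the residue. -/
noncomputable def principalPart (p : ℂ) (N : ℕ) (c : ℕ → ℂ) (s : ℂ) : ℂ :=
  ∑ j ∈ Finset.range N, c j * (s - p) ^ (-(j : ℤ) - 1)

variable {f g h : ℂ → ℂ} {z w p s : ℂ} {N : ℕ} {c : ℕ → ℂ}

lemma analyticAt_principalPart (N : ℕ) (c : ℕ → ℂ) (hs : s ≠ p) :
    AnalyticAt ℂ (principalPart p N c) s :=
  Finset.analyticAt_fun_sum _ fun _ _ => analyticAt_const.mul
    ((analyticAt_id.sub analyticAt_const).zpow (sub_ne_zero.2 hs))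

lemma exists_sub_zpow_neg_mul_eq_principalPart_add (hg : AnalyticAt ℂ g p) (N : ℕ) :
    ∃ (c : ℕ → ℂ) (h : ℂ → ℂ), AnalyticAt ℂ h p ∧
      ∀ s ≠ p, (s - p) ^ (-(N : ℤ)) * g s = principalPart p N c s + h s := by
  induction N generalizing g with
  | zero => exact ⟨0, g, hg, fun s _ => by simp [principalPart]⟩
  | succ N ih =>
    obtain ⟨c, h, hh, hc⟩ := ih (analyticAt_dslope hg)
    refine ⟨Function.update c N (g p), h, hh, fun s hs => ?_⟩
    have hsp : s - p ≠ 0 := sub_ne_zero.2 hs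
    have hdslope : g s = g p + (s - p) * dslope g p s :=
      eq_add_of_sub_eq' (sub_smul_dslope g p s).symm
    have hzpow : (s - p) ^ (-(N : ℤ) - 1) * (s - p) = (s - p) ^ (-(N : ℤ)) := by
      rw [zpow_sub_one₀ hsp, inv_mul_cancel_right₀ hsp]
    have hpp : principalPart p (N + 1) (Function.update c N (g p)) s =
        principalPart p N c s + g p * (s - p) ^ (-(N : ℤ) - 1) := by
      rw [principalPart, Finset.sum_range_succ, Function.update_self]
      congr 1
      exact Finset.sum_congr rfl fun j hj => by
        rw [Function.update_of_ne (Finset.mem_range.1 hj).ne]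
    rw [hdslope, Nat.cast_succ, neg_add', mul_add, ← mul_assoc, hzpow, hc s hs, hpp]
    ring

lemma exists_eq_principalPart_add (hf : MeromorphicAt f p) :
    ∃ (N : ℕ) (c : ℕ → ℂ) (h : ℂ → ℂ), AnalyticAt ℂ h p ∧
      ∀ s ≠ p, f s = principalPart p (N + 1) c s + h s := by
  obtain ⟨N, hN⟩ := hf
  obtain ⟨c, h, hh, hc⟩ := exists_sub_zpow_neg_mul_eq_principalPart_add
    ((analyticAt_id.sub (analyticAt_const (v := p))).mul hN) (N + 1)
  refine ⟨N, c, h, hh, fun s hs => ?_⟩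
  have := sub_ne_zero.2 hs
  rw [← hc s hs, zpow_neg, zpow_natCast]
  simp only [Pi.mul_apply, Pi.sub_apply, id, smul_eq_mul]
  field_simp
  ring

lemma circleIntegral_principalPart (p : ℂ) (N : ℕ) (c : ℕ → ℂ) {r : ℝ} (hr : 0 < r) :
    (∮ s in C(p, r), principalPart p (N + 1) c s) = 2 * π * I * c 0 := by
  have hint (m : ℤ) : CircleIntegrable (fun s => (s - p) ^ m) p r :=
    circleIntegrable_sub_zpow_iff.2 (.inr (.inr (by simp [abs_of_pos hr, hr.ne])))
  have hzero (j : ℕ) : (∮ s in C(p, r), (s - p) ^ (-((j + 1 : ℕ) : ℤ) - 1)) = 0 :=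
    circleIntegral.integral_sub_zpow_of_ne (by push_cast; lia) ..
  have hsum := circleIntegral.integral_fun_sum (s := Finset.range (N + 1))
    fun j _ => (hint (-(j : ℤ) - 1)).const_fun_smul (a := c j)
  refine hsum.trans ?_
  simp only [smul_eq_mul, circleIntegral.integral_const_mul, Finset.sum_range_succ', hzero]
  simp [circleIntegral.integral_sub_center_inv p hr.ne', mul_comm]

lemma rectIntegral_principalPart (hp : p ∈ openRect z w) (N : ℕ) (c : ℕ → ℂ) :
    rectIntegral (principalPart p (N + 1) c) z w = 2 * π * I * c 0 := by
  have hzero (j : ℕ) : rectIntegral (fun s => (s - p) ^ (-((j + 1 : ℕ) : ℤ) - 1)) z w = 0 :=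
    rectIntegral_sub_zpow hp (by push_cast; lia)
  have hsum := rectIntegral_sum (Finset.range (N + 1)) (fun j s => c j * (s - p) ^ (-(j : ℤ) - 1))
    (re_le_re_of_mem_openRect hp) (im_le_im_of_mem_openRect hp)
    fun j _ => continuousOn_const.mul (continuousOn_sub_zpow_rectBoundary hp _)
  refine hsum.trans ?_
  simp only [rectIntegral_const_mul, Finset.sum_range_succ', hzero]
  simp [rectIntegral_sub_inv hp, mul_comm]

lemma residue_eq_of_eq_principalPart_add (hh : AnalyticAt ℂ h p)
    (hf : ∀ s ≠ p, f s = principalPart p (N + 1) c s + h s) : residue f p = c 0 := by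
  refine Tendsto.limUnder_eq (tendsto_const_nhds.congr' ?_)
  obtain ⟨ε, hε, hball⟩ := Metric.eventually_nhds_iff_ball.1 hh.eventually_analyticAt
  filter_upwards [Ioo_mem_nhdsGT hε] with r ⟨hr, hrε⟩
  have hdiff : DifferentiableOn ℂ h (Metric.closedBall p r) := fun s hs =>
    (hball s (Metric.closedBall_subset_ball hrε hs)).differentiableAt.differentiableWithinAt
  have hzero : (∮ s in C(p, r), h s) = 0 :=
    hdiff.diffContOnCl_ball subset_rfl |>.circleIntegral_eq_zero hr.le
  have hne (s) (hs : s ∈ Metric.sphere p r) : s ≠ p := Metric.ne_of_mem_sphere hs hr.ne'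
  have hpp : CircleIntegrable (principalPart p (N + 1) c) p r :=
    ContinuousOn.circleIntegrable hr.le fun s hs =>
      (analyticAt_principalPart _ _ (hne s hs)).continuousAt.continuousWithinAt
  rw [circleIntegral.integral_congr hr.le fun s hs => hf s (hne s hs),
    circleIntegral.integral_add hpp, hzero, add_zero, circleIntegral_principalPart p N c hr,
    inv_mul_cancel_left₀ Complex.two_pi_I_ne_zero]
  exact (hdiff.continuousOn.mono Metric.sphere_subset_closedBall).circleIntegrable hr.le

lemma residue_eq_of_eq_inv_mul (hg : AnalyticAt ℂ g p) (hf : ∀ s ≠ p, f s = (s - p)⁻¹ * g s) :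
    residue f p = g p := by
  refine residue_eq_of_eq_principalPart_add (N := 0) (c := fun _ => g p) (analyticAt_dslope hg)
    fun s hs => ?_
  have hsp : s - p ≠ 0 := sub_ne_zero.2 hs
  have hdslope : g s = g p + (s - p) * dslope g p s :=
    eq_add_of_sub_eq' (sub_smul_dslope g p s).symm
  rw [hf s hs, hdslope, mul_add, inv_mul_cancel_left₀ hsp]
  simp [principalPart, mul_comm]

lemma residue_div_of_deriv_ne_zero (hf : AnalyticAt ℂ f p) (hg : AnalyticAt ℂ g p) (hgp : g p = 0)
    (hg' : deriv g p ≠ 0) : residue (fun s => f s / g s) p = f p / deriv g p := by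
  rw [← dslope_same] at hg' ⊢
  refine residue_eq_of_eq_inv_mul (hf.fun_div (analyticAt_dslope hg) hg') fun s _ => ?_
  have hfactor : g s = (s - p) * dslope g p s := by
    rw [← smul_eq_mul, sub_smul_dslope, hgp, sub_zero]
  rw [hfactor, ← div_eq_inv_mul, div_div, mul_comm]

lemma residue_congr (hfg : f =ᶠ[𝓝[≠] p] g) : residue f p = residue g p := by
  rw [EventuallyEq, eventually_nhdsWithin_iff, Metric.eventually_nhds_iff_ball] at hfg
  obtain ⟨ε, hε, hball⟩ := hfg
  refine congrArg lim (Filter.map_congr ?_)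
  filter_upwards [Ioo_mem_nhdsGT hε] with r ⟨hr, hrε⟩
  rw [circleIntegral.integral_congr hr.le fun s hs => hball s
    (Metric.sphere_subset_closedBall.trans (Metric.closedBall_subset_ball hrε) hs)
    (Metric.ne_of_mem_sphere hs hr.ne')]

lemma residue_add_of_analyticAt (hg : AnalyticAt ℂ g p) (hh : MeromorphicAt h p) :
    residue (g + h) p = residue h p := by
  obtain ⟨N, c, k, hk, hh⟩ := exists_eq_principalPart_add hh
  rw [residue_eq_of_eq_principalPart_add hk hh]
  refine residue_eq_of_eq_principalPart_add (N := N) (hk.add hg) fun s hs => ?_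
  rw [Pi.add_apply, Pi.add_apply, hh s hs]
  ring

/-- The residue theorem: subtract the principal parts one at a time. -/
theorem rectIntegral_eq_sum_residue (hre : z.re ≤ w.re) (him : z.im ≤ w.im) (P : Finset ℂ)
    (hP : ∀ p ∈ P, p ∈ openRect z w) (hd : ∀ s ∈ closedRect z w, s ∉ P → DifferentiableAt ℂ f s)
    (hm : ∀ p ∈ P, MeromorphicAt f p) :
    rectIntegral f z w = 2 * π * I * ∑ p ∈ P, residue f p := by
  classical
  induction P using Finset.induction_on generalizing f with
  | empty => simp [rectIntegral_eq_zero_of_differentiableAt hre him fun s hs => hd s hs (by simp)]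
  | insert p P hpP ih =>
    rw [Finset.forall_mem_insert] at hP hm
    obtain ⟨N, c, h, hh, hf⟩ := exists_eq_principalPart_add hm.1
    have hoff (s) (hs : s ≠ p) : f =ᶠ[𝓝 s] principalPart p (N + 1) c + h :=
      eventually_of_mem (isOpen_ne.mem_nhds hs) hf
    have hheq (s) (hs : s ≠ p) : h =ᶠ[𝓝 s] f - principalPart p (N + 1) c :=
      (hoff s hs).mono fun u hu => by simp [hu]
    have hhd (s) (hs : s ∈ closedRect z w) (hsP : s ∉ P) : DifferentiableAt ℂ h s := by
      by_cases hsp : s = p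
      · exact hsp ▸ hh.differentiableAt
      · exact ((hd s hs (by simp [hsp, hsP])).sub
          (analyticAt_principalPart _ _ hsp).differentiableAt).congr_of_eventuallyEq (hheq s hsp)
    have hhm (q) (hq : q ∈ P) : MeromorphicAt h q :=
      have hqp := ne_of_mem_of_not_mem hq hpP
      ((hm.2 q hq).sub (analyticAt_principalPart _ _ hqp).meromorphicAt).congr
        ((hheq q hqp).symm.filter_mono nhdsWithin_le_nhds)
    have hres (q) (hq : q ∈ P) : residue f q = residue h q :=
      have hqp := ne_of_mem_of_not_mem hq hpP
      (residue_congr ((hoff q hqp).filter_mono nhdsWithin_le_nhds)).trans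
        (residue_add_of_analyticAt (analyticAt_principalPart _ _ hqp) (hhm q hq))
    have hhc : ContinuousOn h (rectBoundary z w) := fun s hs =>
      (hhd s hs.1 fun hsP => hs.2 (hP.2 s hsP)).continuousAt.continuousWithinAt
    have hppc : ContinuousOn (principalPart p (N + 1) c) (rectBoundary z w) := fun s hs =>
      (analyticAt_principalPart _ _
        (ne_of_mem_rectBoundary hP.1 hs)).continuousAt.continuousWithinAt
    rw [rectIntegral_congr hre him fun s hs => hf s (ne_of_mem_rectBoundary hP.1 hs),
      rectIntegral_add hre him hppc hhc, rectIntegral_principalPart hP.1, ih hP.2 hhd hhm,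
      Finset.sum_insert hpP, residue_eq_of_eq_principalPart_add hh hf, Finset.sum_congr rfl hres,
      mul_add]

end Residue

/-! ### Perron's formula -/

section Perron

/-- `(2πi)⁻¹ ∫ f(s) ds` over the segment from `c - iT` to `c + iT`. -/
noncomputable def verticalIntegral (f : ℂ → ℂ) (c T : ℝ) : ℂ :=
  (2 * π : ℂ)⁻¹ * ∫ t : ℝ in -T..T, f (c + t * I)

/-- The kernel `y^s / s` of Perron's formula. -/
noncomputable def perronKernel (y : ℝ) (s : ℂ) : ℂ := (y : ℂ) ^ s / s

/-- The value of `(2πi)⁻¹ ∫ y^s / s ds` over a vertical line in the right half-plane, taken as a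
principal value. -/
noncomputable def perronLimit (y : ℝ) : ℝ :=
  if y < 1 then 0 else if y = 1 then 1 / 2 else 1

variable {f : ℂ → ℂ} {b c y T : ℝ} {s : ℂ}

lemma verticalIntegral_neg (f : ℂ → ℂ) (c T : ℝ) :
    verticalIntegral f (-c) T = verticalIntegral (fun s => f (-s)) c T := by
  have h := intervalIntegral.integral_comp_neg (a := -T) (b := T)
    (fun t : ℝ => f ((-c : ℝ) + t * I))
  rw [neg_neg] at h
  rw [verticalIntegral, verticalIntegral, ← h]
  simp only [Complex.ofReal_neg, neg_add, neg_mul]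

lemma verticalIntegral_sub_verticalIntegral (f : ℂ → ℂ) (b c T : ℝ) :
    verticalIntegral f c T - verticalIntegral f b T = (2 * π * I)⁻¹ *
      (rectIntegral f ⟨b, -T⟩ ⟨c, T⟩ + (∫ x : ℝ in b..c, f (x + T * I)) -
        ∫ x : ℝ in b..c, f (x + (-T : ℝ) * I)) := by
  simp only [verticalIntegral, rectIntegral, mul_inv, Complex.inv_I]
  linear_combination (2 * π : ℂ)⁻¹ * ((∫ t : ℝ in -T..T, f (c + t * I)) -
    ∫ t : ℝ in -T..T, f (b + t * I)) * Complex.I_mul_I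

lemma norm_verticalIntegral_sub_sub_rectIntegral_le {A : ℝ}
    (htop : ‖∫ x : ℝ in b..c, f (x + T * I)‖ ≤ A)
    (hbottom : ‖∫ x : ℝ in b..c, f (x + (-T : ℝ) * I)‖ ≤ A) :
    ‖verticalIntegral f c T - verticalIntegral f b T -
      (2 * π * I)⁻¹ * rectIntegral f ⟨b, -T⟩ ⟨c, T⟩‖ ≤ π⁻¹ * A := by
  rw [verticalIntegral_sub_verticalIntegral, add_sub_assoc, mul_add, add_sub_cancel_left, norm_mul]
  calc ‖(2 * π * I)⁻¹‖ *
        ‖(∫ x : ℝ in b..c, f (x + T * I)) - ∫ x : ℝ in b..c, f (x + (-T : ℝ) * I)‖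
      ≤ (2 * π)⁻¹ * (A + A) := by
        gcongr
        · simp [abs_of_pos Real.pi_pos]
        · exact (norm_sub_le _ _).trans (add_le_add htop hbottom)
    _ = π⁻¹ * A := by
        field_simp
        ring

lemma differentiableAt_perronKernel (hy : 0 < y) (hs : s ≠ 0) :
    DifferentiableAt ℂ (perronKernel y) s :=
  (differentiableAt_id.const_cpow (.inl (Complex.ofReal_ne_zero.2 hy.ne'))).div
    differentiableAt_id hs

lemma analyticAt_const_cpow (hy : 0 < y) : AnalyticAt ℂ (fun s : ℂ => (y : ℂ) ^ s) s :=
  analyticAt_const.cpow analyticAt_id (.inl (by simpa using hy))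

lemma residue_perronKernel (hy : 0 < y) : residue (perronKernel y) 0 = 1 := by
  rw [residue_eq_of_eq_inv_mul (analyticAt_const_cpow hy) fun s _ => by
    rw [sub_zero, perronKernel, div_eq_inv_mul]]
  exact Complex.cpow_zero _

lemma norm_perronKernel (hy : 0 < y) (s : ℂ) : ‖perronKernel y s‖ = y ^ s.re / ‖s‖ := by
  rw [perronKernel, norm_div, Complex.norm_cpow_eq_rpow_re_of_pos hy]

lemma norm_perronKernel_le_div_im (hy : 0 < y) (hs : s.im ≠ 0) :
    ‖perronKernel y s‖ ≤ y ^ s.re / |s.im| := by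
  rw [norm_perronKernel hy]
  gcongr
  exact Complex.abs_im_le_norm s

lemma norm_perronKernel_le_div_re (hy : 0 < y) (hs : 0 < s.re) :
    ‖perronKernel y s‖ ≤ y ^ s.re / s.re := by
  rw [norm_perronKernel hy]
  gcongr
  exact Complex.re_le_norm s

lemma perronKernel_neg (hy : 0 < y) (s : ℂ) : perronKernel y (-s) = -perronKernel y⁻¹ s := by
  rw [perronKernel, perronKernel, Complex.cpow_neg, Complex.ofReal_inv, Complex.inv_cpow, div_neg]
  rw [Complex.arg_ofReal_of_nonneg hy.le]
  exact Real.pi_pos.ne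

lemma integral_const_rpow_le (hy0 : 0 < y) (hy1 : y < 1) :
    ∫ x : ℝ in c..b, y ^ x ≤ y ^ c / -Real.log y := by
  have hlog : Real.log y < 0 := Real.log_neg hy0 hy1
  have hderiv (x : ℝ) : HasDerivAt (fun x : ℝ => y ^ x / Real.log y) (y ^ x) x := by
    simpa [hlog.ne] using
      (Real.hasStrictDerivAt_const_rpow hy0 x).hasDerivAt.div_const (Real.log y)
  rw [intervalIntegral.integral_eq_sub_of_hasDerivAt (fun x _ => hderiv x)
    (Real.continuous_const_rpow hy0.ne' |>.intervalIntegrable _ _), div_neg]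
  linarith [div_nonpos_of_nonneg_of_nonpos (Real.rpow_nonneg hy0.le b) hlog.le]

lemma norm_integral_perronKernel_horizontal_le (hy0 : 0 < y) (hy1 : y < 1) (hcb : c ≤ b)
    (hT : T ≠ 0) :
    ‖∫ x : ℝ in c..b, perronKernel y (x + T * I)‖ ≤ y ^ c / -Real.log y / |T| := by
  have hint : IntervalIntegrable (fun x : ℝ => y ^ x / |T|) volume c b :=
    ((Real.continuous_const_rpow hy0.ne').div_const _).intervalIntegrable _ _
  calc ‖∫ x : ℝ in c..b, perronKernel y (x + T * I)‖
      ≤ ∫ x : ℝ in c..b, y ^ x / |T| :=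
        intervalIntegral.norm_integral_le_of_norm_le hcb (.of_forall fun x _ => by
          simpa using norm_perronKernel_le_div_im (s := x + T * I) hy0 (by simpa using hT)) hint
    _ = (∫ x : ℝ in c..b, y ^ x) / |T| := intervalIntegral.integral_div _ _
    _ ≤ y ^ c / -Real.log y / |T| := by
        gcongr
        exact integral_const_rpow_le hy0 hy1

lemma norm_verticalIntegral_perronKernel_le_div (hy : 0 < y) (hc : 0 < c) (hT : 0 ≤ T) :
    ‖verticalIntegral (perronKernel y) c T‖ ≤ π⁻¹ * (y ^ c / c * T) := by
  have hbound : ‖∫ t : ℝ in -T..T, perronKernel y (c + t * I)‖ ≤ y ^ c / c * |T - -T| :=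
    intervalIntegral.norm_integral_le_of_norm_le_const fun t _ => by
      simpa using norm_perronKernel_le_div_re (s := c + t * I) hy (by simpa using hc)
  rw [sub_neg_eq_add, ← two_mul, abs_of_nonneg (by positivity)] at hbound
  calc ‖verticalIntegral (perronKernel y) c T‖
      ≤ (2 * π)⁻¹ * (y ^ c / c * (2 * T)) := by
        rw [verticalIntegral, norm_mul]
        gcongr
        simp [abs_of_pos Real.pi_pos]
    _ = π⁻¹ * (y ^ c / c * T) := by
        field_simp

/-- Move the line of integration to the right, where the integrand tends to `0`. -/
lemma norm_verticalIntegral_perronKernel_le (hy0 : 0 < y) (hy1 : y < 1) (hc : 0 < c) (hT : 0 < T) :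
    ‖verticalIntegral (perronKernel y) c T‖ ≤ π⁻¹ * (y ^ c / -Real.log y / T) := by
  have hbound (b : ℝ) (hb : c ≤ b) : ‖verticalIntegral (perronKernel y) c T‖ ≤
      π⁻¹ * (y ^ c / -Real.log y / T) + π⁻¹ * (y ^ b / b * T) := by
    have hrect : rectIntegral (perronKernel y) ⟨c, -T⟩ ⟨b, T⟩ = 0 :=
      rectIntegral_eq_zero_of_differentiableAt hb (by simpa using hT.le) fun s hs =>
        differentiableAt_perronKernel hy0 (by rintro rfl; exact hc.not_ge hs.1.1)
    have htop := norm_integral_perronKernel_horizontal_le hy0 hy1 hb hT.ne'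
    have hbottom := norm_integral_perronKernel_horizontal_le hy0 hy1 hb (neg_ne_zero.2 hT.ne')
    rw [abs_neg] at hbottom
    have hdiff := norm_verticalIntegral_sub_sub_rectIntegral_le htop hbottom
    rw [hrect, mul_zero, sub_zero, abs_of_pos hT, norm_sub_rev] at hdiff
    exact (norm_le_norm_sub_add _ _).trans (add_le_add hdiff
      (norm_verticalIntegral_perronKernel_le_div hy0 (hc.trans_le hb) hT.le))
  have hlim : Tendsto (fun b : ℝ => π⁻¹ * (y ^ c / -Real.log y / T) + π⁻¹ * (y ^ b / b * T)) atTop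
      (𝓝 (π⁻¹ * (y ^ c / -Real.log y / T) + π⁻¹ * (0 * T))) :=
    tendsto_const_nhds.add (((tendsto_rpow_atTop_of_base_lt_one y (by linarith) hy1).div_atTop
      tendsto_id).mul_const _ |>.const_mul _)
  rw [zero_mul, mul_zero, add_zero] at hlim
  exact ge_of_tendsto hlim ((eventually_ge_atTop c).mono hbound)

lemma rpow_le_rpow_add_rpow_neg (hy : 0 < y) {x : ℝ} (hx : |x| ≤ c) : y ^ x ≤ y ^ c + y ^ (-c) := by
  rw [abs_le] at hx
  rcases le_total 1 y with h | h
  · exact (Real.rpow_le_rpow_of_exponent_le h hx.2).trans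
      (le_add_of_nonneg_right (Real.rpow_nonneg hy.le _))
  · exact (Real.rpow_le_rpow_of_exponent_ge hy h hx.1).trans
      (le_add_of_nonneg_left (Real.rpow_nonneg hy.le _))

lemma rectIntegral_perronKernel (hy : 0 < y) (hc : 0 < c) (hT : 0 < T) :
    rectIntegral (perronKernel y) ⟨-c, -T⟩ ⟨c, T⟩ = 2 * π * I := by
  rw [rectIntegral_eq_sum_residue (by simpa using hc.le) (by simpa using hT.le) {0},
    Finset.sum_singleton, residue_perronKernel hy, mul_one]
  · simpa [openRect, Complex.mem_reProdIm] using ⟨hc, hT⟩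
  · exact fun s _ hs => differentiableAt_perronKernel hy (by simpa using hs)
  · exact fun p _ => (analyticAt_const_cpow hy).meromorphicAt.div (MeromorphicAt.id p)

lemma norm_verticalIntegral_perronKernel_add_inv_sub_one_le (hy : 0 < y) (hc : 0 < c) (hT : 0 < T) :
    ‖verticalIntegral (perronKernel y) c T + verticalIntegral (perronKernel y⁻¹) c T - 1‖ ≤
      π⁻¹ * ((y ^ c + y ^ (-c)) / T * (2 * c)) := by
  have horizontal (τ : ℝ) (hτ : |τ| = T) :
      ‖∫ x : ℝ in -c..c, perronKernel y (x + τ * I)‖ ≤ (y ^ c + y ^ (-c)) / T * |c - -c| := by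
    refine intervalIntegral.norm_integral_le_of_norm_le_const fun x hx => ?_
    rw [Set.uIoc_of_le (by linarith)] at hx
    calc ‖perronKernel y (x + τ * I)‖ ≤ y ^ x / |τ| := by
          simpa using norm_perronKernel_le_div_im (s := x + τ * I) hy
            (by simpa using abs_pos.1 (hτ ▸ hT))
      _ ≤ (y ^ c + y ^ (-c)) / T := by
          rw [hτ]
          gcongr
          exact rpow_le_rpow_add_rpow_neg hy (abs_le.2 ⟨hx.1.le, hx.2⟩)
  rw [sub_neg_eq_add, ← two_mul, abs_of_pos (by positivity : 0 < 2 * c)] at horizontal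
  have hdiff := norm_verticalIntegral_sub_sub_rectIntegral_le (horizontal T (abs_of_pos hT))
    (horizontal (-T) (by rw [abs_neg, abs_of_pos hT]))
  have hleft : verticalIntegral (perronKernel y) (-c) T =
      -verticalIntegral (perronKernel y⁻¹) c T := by
    simp only [verticalIntegral_neg, perronKernel_neg hy]
    simp [verticalIntegral]
  rwa [rectIntegral_perronKernel hy hc hT, inv_mul_cancel₀ Complex.two_pi_I_ne_zero, hleft,
    sub_neg_eq_add] at hdiff

lemma tendsto_verticalIntegral_perronKernel_of_lt_one (hy0 : 0 < y) (hy1 : y < 1) (hc : 0 < c) :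
    Tendsto (verticalIntegral (perronKernel y) c) atTop (𝓝 0) := by
  refine squeeze_zero_norm' ((eventually_gt_atTop 0).mono fun T hT =>
    norm_verticalIntegral_perronKernel_le hy0 hy1 hc hT) ?_
  simpa using (tendsto_id.const_div_atTop (y ^ c / -Real.log y)).const_mul π⁻¹

lemma tendsto_verticalIntegral_perronKernel_add_inv (hy : 0 < y) (hc : 0 < c) :
    Tendsto (fun T => verticalIntegral (perronKernel y) c T +
      verticalIntegral (perronKernel y⁻¹) c T) atTop (𝓝 1) := by
  refine tendsto_sub_nhds_zero_iff.1 (squeeze_zero_norm' ((eventually_gt_atTop 0).mono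
    fun T hT => norm_verticalIntegral_perronKernel_add_inv_sub_one_le hy hc hT) ?_)
  simpa using ((tendsto_id.const_div_atTop (y ^ c + y ^ (-c))).mul_const (2 * c)).const_mul π⁻¹

theorem tendsto_verticalIntegral_perronKernel (hy : 0 < y) (hc : 0 < c) :
    Tendsto (verticalIntegral (perronKernel y) c) atTop (𝓝 (perronLimit y : ℂ)) := by
  unfold perronLimit
  split_ifs with hlt heq
  · simpa using tendsto_verticalIntegral_perronKernel_of_lt_one hy hlt hc
  · subst heq
    simpa using (tendsto_verticalIntegral_perronKernel_add_inv one_pos hc).div_const 2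
  · have hgt : 1 < y := lt_of_le_of_ne (not_lt.1 hlt) (Ne.symm heq)
    simpa using (tendsto_verticalIntegral_perronKernel_add_inv hy hc).sub
      (tendsto_verticalIntegral_perronKernel_of_lt_one (inv_pos.2 hy)
        (inv_lt_one_of_one_lt₀ hgt) hc)

variable {ι : Type*} {u : ι → ℝ}

lemma hasSum_verticalIntegral_perronKernel [Countable ι] (hu : ∀ i, 0 < u i) (hc : 0 < c)
    (hsum : Summable fun i => u i ^ c)
    (hf : ∀ t : ℝ, HasSum (fun i => perronKernel (u i) (c + t * I)) (f (c + t * I))) (T : ℝ) :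
    HasSum (fun i => verticalIntegral (perronKernel (u i)) c T) (verticalIntegral f c T) := by
  have hne (t : ℝ) : (c + t * I : ℂ) ≠ 0 := fun h => hc.ne' (by simpa using congrArg Complex.re h)
  refine HasSum.mul_left _ (intervalIntegral.hasSum_integral_of_dominated_convergence
    (fun i _ => u i ^ c / c) (fun i => ?_) (fun i => .of_forall fun t _ => ?_)
    (.of_forall fun _ _ => hsum.div_const c) (by simp) (.of_forall fun t _ => hf t))
  · exact (continuous_iff_continuousAt.2 fun t =>
      (differentiableAt_perronKernel (hu i) (hne t)).continuousAt.comp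
        (f := fun t : ℝ => (c + t * I : ℂ)) (by fun_prop)).aestronglyMeasurable
  · simpa using norm_perronKernel_le_div_re (s := c + t * I) (hu i) (by simpa using hc)

lemma norm_verticalIntegral_perronKernel_le_rpow (hy0 : 0 < y) (hy : y < 1 / 2) (hc : 0 < c)
    (hT : 1 ≤ T) : ‖verticalIntegral (perronKernel y) c T‖ ≤ y ^ c := by
  have hlog : 1 / 2 ≤ -Real.log y := by
    have := Real.log_le_log hy0 hy.le
    rw [one_div, Real.log_inv] at this
    linarith [Real.log_two_gt_d9]
  calc ‖verticalIntegral (perronKernel y) c T‖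
      ≤ π⁻¹ * (y ^ c / -Real.log y / T) :=
        norm_verticalIntegral_perronKernel_le hy0 (by linarith) hc (by linarith)
    _ ≤ 2⁻¹ * (y ^ c / (1 / 2) / 1) := by
        have := Real.two_le_pi
        gcongr
    _ = y ^ c := by ring

theorem tendsto_tsum_verticalIntegral_perronKernel (hu : ∀ i, 0 < u i) (hc : 0 < c)
    (hsum : Summable fun i => u i ^ c) :
    Tendsto (fun T => ∑' i, verticalIntegral (perronKernel (u i)) c T) atTop
      (𝓝 (∑' i, (perronLimit (u i) : ℂ))) := by
  have hfin : {i | ¬ u i < 1 / 2}.Finite := by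
    filter_upwards [hsum.tendsto_cofinite_zero.eventually
      (gt_mem_nhds (Real.rpow_pos_of_pos one_half_pos c))] with i hi
    exact (Real.rpow_lt_rpow_iff (hu i).le one_half_pos.le hc).1 hi
  have hmajorant : Summable fun i => 2 * (2 * u i) ^ c := by
    simp only [Real.mul_rpow two_pos.le (hu _).le]
    exact (hsum.mul_left _).mul_left 2
  refine tendsto_tsum_of_dominated_convergence hmajorant
    (fun i => tendsto_verticalIntegral_perronKernel (hu i) hc) ?_
  have hlarge : ∀ᶠ T in atTop, ∀ i ∈ {i | ¬ u i < 1 / 2},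
      ‖verticalIntegral (perronKernel (u i)) c T‖ ≤ 2 := by
    rw [eventually_all_finite hfin]
    refine fun i _ => (tendsto_verticalIntegral_perronKernel (hu i) hc).norm.eventually_le_const ?_
    unfold perronLimit
    split_ifs <;> norm_num
  filter_upwards [hlarge, eventually_ge_atTop 1] with T hTlarge hT i
  by_cases hi : u i < 1 / 2
  · have hpow : u i ^ c ≤ (2 * u i) ^ c :=
      Real.rpow_le_rpow (hu i).le (by linarith [hu i]) hc.le
    linarith [norm_verticalIntegral_perronKernel_le_rpow (hu i) hi hc hT,
      Real.rpow_nonneg (hu i).le c]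
  · linarith [hTlarge i hi, Real.one_le_rpow (by linarith : 1 ≤ 2 * u i) hc.le]

theorem tendsto_verticalIntegral_of_hasSum [Countable ι] (hu : ∀ i, 0 < u i) (hc : 0 < c)
    (hsum : Summable fun i => u i ^ c)
    (hf : ∀ t : ℝ, HasSum (fun i => perronKernel (u i) (c + t * I)) (f (c + t * I))) :
    Tendsto (verticalIntegral f c) atTop (𝓝 (∑' i, (perronLimit (u i) : ℂ))) :=
  (tendsto_tsum_verticalIntegral_perronKernel hu hc hsum).congr fun T =>
    (hasSum_verticalIntegral_perronKernel hu hc hsum hf T).tsum_eq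

end Perron

/-! ### The Euler product -/

section EulerProduct

variable {ι 𝕜 : Type*} {n : ℕ} {a : Fin n → ℕ} {s : ℂ}

lemma summable_norm_prod [NormedField 𝕜] {f : Fin n → ι → 𝕜}
    (hf : ∀ k, Summable fun i => ‖f k i‖) :
    Summable fun q : Fin n → ι => ‖∏ k, f k (q k)‖ := by
  induction n with
  | zero => exact (hasSum_unique _).summable
  | succ n ih =>
    let e : ι × (Fin n → ι) ≃ (Fin (n + 1) → ι) := Fin.consEquiv fun _ => ι
    have he (p : ι × (Fin n → ι)) :
        ‖∏ k, f k (e p k)‖ = ‖f 0 p.1‖ * ‖∏ k, f k.succ (p.2 k)‖ := by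
      rw [← norm_mul]
      exact congrArg norm (Fin.prod_univ_succ _)
    refine e.summable_iff.1 ?_
    simpa only [Function.comp_def, he] using (hf 0).mul_of_nonneg (ih fun k => hf k.succ)
      (fun _ => norm_nonneg _) (fun _ => norm_nonneg _)

lemma hasSum_prod_tsum [NormedField 𝕜] [CompleteSpace 𝕜] {f : Fin n → ι → 𝕜}
    (hf : ∀ k, Summable fun i => ‖f k i‖) :
    HasSum (fun q : Fin n → ι => ∏ k, f k (q k)) (∏ k, ∑' i, f k i) := by
  refine (summable_norm_prod hf).of_norm.hasSum_iff.2 ?_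
  induction n with
  | zero => simp
  | succ n ih =>
    let e : ι × (Fin n → ι) ≃ (Fin (n + 1) → ι) := Fin.consEquiv fun _ => ι
    calc ∑' q : Fin (n + 1) → ι, ∏ k, f k (q k)
        = ∑' p : ι × (Fin n → ι), ∏ k, f k (e p k) := (e.tsum_eq _).symm
      _ = ∑' p : ι × (Fin n → ι), f 0 p.1 * ∏ k, f k.succ (p.2 k) :=
          tsum_congr fun p => Fin.prod_univ_succ _
      _ = (∑' i, f 0 i) * ∑' q : Fin n → ι, ∏ k, f k.succ (q k) :=
          (tsum_mul_tsum_of_summable_norm (hf 0)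
            (summable_norm_prod (f := fun k => f k.succ) fun k => hf k.succ)).symm
      _ = ∏ k, ∑' i, f k i := by rw [ih fun k => hf k.succ, Fin.prod_univ_succ]

lemma natCast_prod_cpow (S : Finset ι) (b : ι → ℕ) (s : ℂ) :
    ((∏ k ∈ S, b k : ℕ) : ℂ) ^ s = ∏ k ∈ S, (b k : ℂ) ^ s :=
  map_prod (⟨⟨fun m => (m : ℂ) ^ s, by simp⟩, by simp [Complex.natCast_mul_natCast_cpow]⟩ :
    ℕ →* ℂ) b S

lemma natCast_powerProduct_cpow (a q : Fin n → ℕ) (s : ℂ) :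
    (powerProduct a q : ℂ) ^ s = ∏ k, ((a k : ℂ) ^ s) ^ q k := by
  rw [powerProduct, natCast_prod_cpow]
  exact Finset.prod_congr rfl fun k _ => by
    rw [Nat.cast_pow, ← Complex.natCast_cpow_natCast_mul, Complex.cpow_nat_mul]

lemma norm_natCast_cpow_neg_lt_one {b : ℕ} (hb : 1 < b) (hs : 0 < s.re) :
    ‖(b : ℂ) ^ (-s)‖ < 1 := by
  rw [Complex.norm_natCast_cpow_of_pos (zero_lt_one.trans hb)]
  exact Real.rpow_lt_one_of_one_lt_of_neg (mod_cast hb) (by simpa using hs)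

lemma summable_norm_geometric_natCast_cpow_neg {b : ℕ} (hb : 1 < b) (hs : 0 < s.re) :
    Summable fun e : ℕ => ‖((b : ℂ) ^ (-s)) ^ e‖ :=
  summable_norm_geometric_of_norm_lt_one (norm_natCast_cpow_neg_lt_one hb hs)

lemma summable_norm_powerProduct_cpow_neg (ha : ∀ k, 1 < a k) (hs : 0 < s.re) :
    Summable fun q => ‖(powerProduct a q : ℂ) ^ (-s)‖ := by
  simpa only [natCast_powerProduct_cpow] using
    summable_norm_prod fun k => summable_norm_geometric_natCast_cpow_neg (ha k) hs

lemma hasSum_powerProduct_cpow_neg (ha : ∀ k, 1 < a k) (hs : 0 < s.re) :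
    HasSum (fun q => (powerProduct a q : ℂ) ^ (-s)) (∏ k, (1 - 1 / (a k : ℂ) ^ s)⁻¹) := by
  simpa only [natCast_powerProduct_cpow, one_div, ← Complex.cpow_neg,
    tsum_geometric_of_norm_lt_one (norm_natCast_cpow_neg_lt_one (ha _) hs)] using
    hasSum_prod_tsum fun k => summable_norm_geometric_natCast_cpow_neg (ha k) hs

lemma powerProduct_pos (ha : ∀ k, 1 < a k) (q : Fin n → ℕ) : 0 < powerProduct a q :=
  Finset.prod_pos fun k _ => pow_pos (zero_lt_one.trans (ha k)) _

lemma powerProduct_single (a : Fin n → ℕ) (k : Fin n) (e : ℕ) :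
    powerProduct a (Pi.single k e) = a k ^ e := by
  rw [powerProduct, Fintype.prod_eq_single k fun j hj => by rw [Pi.single_eq_of_ne hj, pow_zero],
    Pi.single_eq_same]

lemma one_lt_of_powerProduct_injective (hinj : Function.Injective (powerProduct a)) (k : Fin n) :
    1 < a k := by
  have hpow : Function.Injective fun e => a k ^ e := by
    simpa only [Function.comp_def, powerProduct_single] using
      hinj.comp (Pi.single_injective (M := fun _ : Fin n => ℕ) k)
  by_contra! hk
  interval_cases a k
  · exact absurd (hpow (a₁ := 1) (a₂ := 2) (by simp)) (by decide)
  · exact absurd (hpow (a₁ := 0) (a₂ := 1) (by simp)) (by decide)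

lemma finite_powerProduct_le (hinj : Function.Injective (powerProduct a)) (x : ℝ) :
    {q : Fin n → ℕ | (powerProduct a q : ℝ) ≤ x}.Finite :=
  ((Set.finite_Iic ⌊x⌋₊).preimage hinj.injOn).subset fun _ hq => Nat.le_floor hq

lemma hasSum_powerProduct_le (hinj : Function.Injective (powerProduct a)) (x : ℝ) :
    HasSum (fun q => if (powerProduct a q : ℝ) ≤ x then (1 : ℝ) else 0) (countProducts a x) := by
  have hfin := finite_powerProduct_le hinj x
  rw [countProducts, Set.ncard_eq_toFinset_card _ hfin, Finset.cast_card,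
    Finset.sum_congr rfl fun q hq => (if_pos (hfin.mem_toFinset.1 hq)).symm]
  exact hasSum_sum_of_ne_finset_zero fun q hq => if_neg fun h => hq (hfin.mem_toFinset.2 h)

lemma hasSum_powerProduct_eq (hinj : Function.Injective (powerProduct a)) (x : ℝ) :
    HasSum (fun q => if (powerProduct a q : ℝ) = x then (1 : ℝ) else 0) (productChi a x) := by
  unfold productChi
  by_cases hx : x ∈ productSet a
  · obtain ⟨q₀, rfl⟩ := hx
    rw [Set.indicator_of_mem (s := productSet a) ⟨q₀, rfl⟩]
    simpa only [Nat.cast_inj, hinj.eq_iff] using hasSum_ite_eq q₀ (1 : ℝ)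
  · rw [Set.indicator_of_notMem hx]
    exact hasSum_zero.congr_fun fun q => if_neg fun h => hx ⟨q, h⟩

lemma perronLimit_div {u : ℝ} (hu : 0 < u) (x : ℝ) :
    perronLimit (x / u) = (if u ≤ x then 1 else 0) - 1 / 2 * if u = x then 1 else 0 := by
  simp only [perronLimit, div_lt_one hu, div_eq_one_iff_eq hu.ne']
  rcases lt_trichotomy x u with h | rfl | h
  · simp [h, h.not_ge, h.ne']
  · norm_num
  · simp [h.not_gt, h.ne, h.ne', h.le]

lemma hasSum_perronLimit (hinj : Function.Injective (powerProduct a)) (x : ℝ) :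
    HasSum (fun q => perronLimit (x / powerProduct a q))
      (countProducts a x - 1 / 2 * productChi a x) := by
  have hpos (q) : (0 : ℝ) < powerProduct a q :=
    mod_cast powerProduct_pos (one_lt_of_powerProduct_injective hinj) q
  simpa only [perronLimit_div (hpos _)] using
    (hasSum_powerProduct_le hinj x).sub ((hasSum_powerProduct_eq hinj x).mul_left _)

end EulerProduct

/-! ### The integrand on vertical lines -/

section VerticalLines

variable {n : ℕ} {a : Fin n → ℕ} {x c : ℝ} {s : ℂ}

lemma hasSum_perronIntegrand (ha : ∀ k, 1 < a k) (hx : 0 < x) (hs : 0 < s.re) :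
    HasSum (fun q => perronKernel (x / powerProduct a q) s) (perronIntegrand a x s) := by
  have hterm (q : Fin n → ℕ) : perronKernel (x / powerProduct a q) s =
      (x : ℂ) ^ s / s * (powerProduct a q : ℂ) ^ (-s) := by
    rw [perronKernel, Complex.ofReal_div, Complex.div_cpow_ofReal_nonneg hx.le (Nat.cast_nonneg _),
      Complex.ofReal_natCast, Complex.cpow_neg]
    ring
  have hsum : perronIntegrand a x s = (x : ℂ) ^ s / s * ∏ k, (1 - 1 / (a k : ℂ) ^ s)⁻¹ := by
    rw [perronIntegrand, Finset.prod_inv_distrib]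
    ring
  simpa only [hterm, hsum] using (hasSum_powerProduct_cpow_neg ha hs).mul_left ((x : ℂ) ^ s / s)

lemma summable_div_powerProduct_rpow (ha : ∀ k, 1 < a k) (hx : 0 ≤ x) (hc : 0 < c) :
    Summable fun q => (x / powerProduct a q) ^ c := by
  have hsum := summable_norm_powerProduct_cpow_neg ha (s := c) (by simpa using hc)
  refine (hsum.mul_left (x ^ c)).congr fun q => ?_
  rw [Complex.norm_natCast_cpow_of_pos (powerProduct_pos ha q), Complex.neg_re, Complex.ofReal_re,
    Real.rpow_neg (Nat.cast_nonneg _), Real.div_rpow hx (Nat.cast_nonneg _), div_eq_mul_inv]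

lemma tendsto_verticalIntegral_perronIntegrand (hinj : Function.Injective (powerProduct a))
    (hx : 0 < x) (hc : 0 < c) :
    Tendsto (verticalIntegral (perronIntegrand a x) c) atTop
      (𝓝 ((countProducts a x - 1 / 2 * productChi a x : ℝ) : ℂ)) := by
  have ha := one_lt_of_powerProduct_injective hinj
  rw [← (hasSum_perronLimit hinj x).tsum_eq, Complex.ofReal_tsum]
  exact tendsto_verticalIntegral_of_hasSum
    (fun q => div_pos hx (mod_cast powerProduct_pos ha q)) hc
    (summable_div_powerProduct_rpow ha hx.le hc)
    fun t => hasSum_perronIntegrand ha hx (by simpa using hc)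

lemma perronIntegrand_neg (ha : ∀ k, a k ≠ 0) (hx : 0 < x) (s : ℂ) :
    perronIntegrand a x (-s) = (-1) ^ (n + 1) * perronIntegrand a (x * ∏ k, (a k : ℝ))⁻¹ s := by
  have hfactor (k : Fin n) : 1 - 1 / (a k : ℂ) ^ (-s) =
      -1 * ((a k : ℂ) ^ s * (1 - 1 / (a k : ℂ) ^ s)) := by
    have : (a k : ℂ) ^ s ≠ 0 := by simp [Complex.cpow_eq_zero_iff, ha k]
    rw [Complex.cpow_neg]
    field_simp
    ring
  have hkernel : (((x * ∏ k, (a k : ℝ))⁻¹ : ℝ) : ℂ) ^ s =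
      (x : ℂ) ^ (-s) * (∏ k, (a k : ℂ) ^ s)⁻¹ := by
    have hprod : (0 : ℝ) ≤ ∏ k, (a k : ℝ) := by positivity
    have hprod_cpow : ((∏ k, (a k : ℝ) : ℝ) : ℂ) ^ s = ∏ k, (a k : ℂ) ^ s := by
      rw [← natCast_prod_cpow]
      push_cast
      rfl
    rw [Complex.ofReal_inv, Complex.inv_cpow _ _
      (by rw [Complex.arg_ofReal_of_nonneg (by positivity)]; exact Real.pi_pos.ne),
      Complex.ofReal_mul, Complex.mul_cpow_ofReal_nonneg hx.le hprod, hprod_cpow, Complex.cpow_neg,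
      mul_inv]
  have hsign : ((-1 : ℂ) ^ n)⁻¹ = (-1) ^ n := by rw [← inv_pow, inv_neg_one]
  rw [perronIntegrand, perronIntegrand, Finset.prod_congr rfl fun k _ => hfactor k, hkernel]
  simp only [Finset.prod_mul_distrib, Finset.prod_const, Finset.card_univ, Fintype.card_fin,
    div_eq_mul_inv, mul_inv, hsign, inv_neg]
  ring

lemma countProducts_eq_zero (ha : ∀ k, 1 < a k) (hx : x < 1) : countProducts a x = 0 := by
  have hempty : {q : Fin n → ℕ | (powerProduct a q : ℝ) ≤ x} = ∅ :=
    Set.eq_empty_of_forall_notMem fun q hq =>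
      (hx.trans_le (Nat.one_le_cast.2 (powerProduct_pos ha q))).not_ge hq
  rw [countProducts, hempty, Set.ncard_empty]

lemma productChi_eq_zero (ha : ∀ k, 1 < a k) (hx : x < 1) : productChi a x = 0 := by
  refine Set.indicator_of_notMem ?_ _
  rintro ⟨q, hq⟩
  exact hx.not_ge (hq ▸ Nat.one_le_cast.2 (powerProduct_pos ha q))

lemma tendsto_verticalIntegral_perronIntegrand_neg (hinj : Function.Injective (powerProduct a))
    (hx : 1 < x * ∏ k, (a k : ℝ)) (hc : 0 < c) :
    Tendsto (verticalIntegral (perronIntegrand a x) (-c)) atTop (𝓝 0) := by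
  have ha := one_lt_of_powerProduct_injective hinj
  have hx0 : 0 < x := pos_of_mul_pos_left (zero_lt_one.trans hx) (by positivity)
  have hy : (x * ∏ k, (a k : ℝ))⁻¹ < 1 := inv_lt_one_of_one_lt₀ hx
  have hlim := (tendsto_verticalIntegral_perronIntegrand hinj
    (inv_pos.2 (zero_lt_one.trans hx)) hc).const_mul ((-1 : ℂ) ^ (n + 1))
  rw [countProducts_eq_zero ha hy, productChi_eq_zero ha hy] at hlim
  rw [Nat.cast_zero, mul_zero, sub_zero, Complex.ofReal_zero, mul_zero] at hlim
  refine hlim.congr fun T => ?_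
  rw [verticalIntegral_neg, verticalIntegral, verticalIntegral]
  simp only [perronIntegrand_neg (fun k => (zero_lt_one.trans (ha k)).ne') hx0,
    intervalIntegral.integral_const_mul]
  exact mul_left_comm _ _ _

end VerticalLines

/-! ### The integrand on horizontal segments -/

section HorizontalSegments

variable {n b : ℕ} {a : Fin n → ℕ} {x c R δ σ τ : ℝ}

lemma one_div_natCast_cpow (hb : b ≠ 0) (s : ℂ) :
    1 / (b : ℂ) ^ s = Complex.exp (-(Real.log b * s)) := by
  rw [Complex.cpow_def_of_ne_zero (Nat.cast_ne_zero.2 hb), ← Complex.natCast_log, one_div,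
    ← Complex.exp_neg]

lemma abs_sin_half_le_norm_one_sub {ρ : ℝ} (hρ : 0 ≤ ρ) (θ : ℝ) :
    |Real.sin (θ / 2)| ≤ ‖1 - (ρ : ℂ) * Complex.exp (θ * I)‖ := by
  have hrotate : Complex.exp ((-(θ / 2) : ℝ) * I) * (1 - ρ * Complex.exp (θ * I)) =
      Complex.exp ((-(θ / 2) : ℝ) * I) - ρ * Complex.exp ((θ / 2 : ℝ) * I) := by
    rw [mul_sub, mul_one, mul_left_comm, ← Complex.exp_add]
    congr 3
    push_cast
    ring
  calc |Real.sin (θ / 2)| ≤ (1 + ρ) * |Real.sin (θ / 2)| :=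
        le_mul_of_one_le_left (abs_nonneg _) (le_add_of_nonneg_right hρ)
    _ = |(Complex.exp ((-(θ / 2) : ℝ) * I) - ρ * Complex.exp ((θ / 2 : ℝ) * I)).im| := by
        rw [Complex.sub_im, Complex.im_ofReal_mul, Complex.exp_ofReal_mul_I_im,
          Complex.exp_ofReal_mul_I_im, Real.sin_neg, ← neg_add', abs_neg, ← one_add_mul, abs_mul,
          abs_of_nonneg (by positivity : 0 ≤ 1 + ρ)]
    _ ≤ ‖Complex.exp ((-(θ / 2) : ℝ) * I) * (1 - ρ * Complex.exp (θ * I))‖ :=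
        hrotate ▸ Complex.abs_im_le_norm _
    _ = ‖1 - (ρ : ℂ) * Complex.exp (θ * I)‖ := by
        rw [norm_mul, Complex.norm_exp_ofReal_mul_I, one_mul]

lemma two_mul_abs_sub_round_le_abs_sin_pi_mul (t : ℝ) : 2 * |t - round t| ≤ |Real.sin (π * t)| := by
  have hperiod : |Real.sin (π * t)| = |Real.sin (π * (t - round t))| := by
    rw [mul_sub, mul_comm π (round t : ℝ), Real.sin_sub_int_mul_pi, abs_mul, abs_zpow]
    simp
  have hsmall : |π * (t - round t)| ≤ π / 2 := by
    rw [abs_mul, abs_of_pos Real.pi_pos]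
    nlinarith [abs_sub_round t, Real.pi_pos]
  calc 2 * |t - round t| = 2 / π * |π * (t - round t)| := by
        rw [abs_mul, abs_of_pos Real.pi_pos]
        field_simp
    _ ≤ |Real.sin (π * (t - round t))| := Real.mul_abs_le_abs_sin hsmall
    _ = |Real.sin (π * t)| := hperiod.symm

lemma two_mul_le_norm_one_sub_one_div_cpow (hb : b ≠ 0)
    (hδ : ∀ ν : ℤ, δ ≤ |R * Real.log b - ν|) (hτ : |τ| = |2 * π * R|) (σ : ℝ) :
    2 * δ ≤ ‖1 - 1 / (b : ℂ) ^ (σ + τ * I)‖ := by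
  have hpolar : 1 / (b : ℂ) ^ (σ + τ * I) =
      (Real.exp (-(Real.log b * σ)) : ℝ) * Complex.exp ((-(Real.log b * τ) : ℝ) * I) := by
    rw [one_div_natCast_cpow hb, Complex.ofReal_exp, ← Complex.exp_add]
    congr 1
    push_cast
    ring
  have hangle : |Real.sin (π * (R * Real.log b))| = |Real.sin (-(Real.log b * τ) / 2)| := by
    rcases abs_eq_abs.1 hτ with rfl | rfl
    · rw [← abs_neg, ← Real.sin_neg]
      congr 2
      ring
    · congr 2
      ring
  calc 2 * δ ≤ 2 * |R * Real.log b - round (R * Real.log b)| := by gcongr; exact hδ _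
    _ ≤ |Real.sin (-(Real.log b * τ) / 2)| := hangle ▸ two_mul_abs_sub_round_le_abs_sin_pi_mul _
    _ ≤ ‖1 - 1 / (b : ℂ) ^ (σ + τ * I)‖ :=
        hpolar ▸ abs_sin_half_le_norm_one_sub (Real.exp_pos _).le _

lemma norm_perronIntegrand_le (ha : ∀ k, a k ≠ 0) (hx : 0 < x) (hR : 0 < R) (hδ : 0 < δ)
    (hdist : ∀ k, ∀ ν : ℤ, δ ≤ |R * Real.log (a k) - ν|) (hσ : σ ∈ Set.Icc (-c) c)
    (hτ : |τ| = |2 * π * R|) :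
    ‖perronIntegrand a x (σ + τ * I)‖ ≤ (x ^ c + x ^ (-c)) / (2 * π * (2 * δ) ^ n) / R := by
  have hnum : ‖(x : ℂ) ^ (σ + τ * I)‖ ≤ x ^ c + x ^ (-c) := by
    rw [Complex.norm_cpow_eq_rpow_re_of_pos hx]
    simpa using rpow_le_rpow_add_rpow_neg hx (abs_le.2 hσ)
  have him : 2 * π * R ≤ ‖(σ : ℂ) + τ * I‖ :=
    (le_abs_self _).trans (hτ ▸ by simpa using Complex.abs_im_le_norm (σ + τ * I))
  have hprod : (2 * δ) ^ n ≤ ∏ k, ‖1 - 1 / (a k : ℂ) ^ (σ + τ * I)‖ := by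
    simpa using Finset.prod_le_prod (s := Finset.univ) (fun _ _ => by positivity)
      fun k _ => two_mul_le_norm_one_sub_one_div_cpow (ha k) (hdist k) hτ σ
  rw [perronIntegrand, norm_div, norm_mul, norm_prod, div_div]
  refine div_le_div₀ (by positivity) hnum (by positivity) ?_
  calc 2 * π * (2 * δ) ^ n * R = (2 * π * R) * (2 * δ) ^ n := by ring
    _ ≤ _ := by gcongr

lemma AppropriateCutoffs.tendsto_integral_horizontal {R τ : ℕ → ℝ} (hR : AppropriateCutoffs a R)
    (ha : ∀ k, a k ≠ 0) (hx : 0 < x) (hc : 0 ≤ c) (hτ : ∀ j, |τ j| = |2 * π * R j|) :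
    Tendsto (fun j => ∫ σ in (-c)..c, perronIntegrand a x (σ + τ j * I)) atTop (𝓝 0) := by
  obtain ⟨hlim, δ, hδ, hdist⟩ := hR
  set C : ℝ := (x ^ c + x ^ (-c)) / (2 * π * (2 * δ) ^ n)
  have hbound : Tendsto (fun j => C / R j * |c - -c|) atTop (𝓝 0) := by
    simpa using (tendsto_const_nhds.div_atTop hlim).mul_const |c - -c|
  refine squeeze_zero_norm' ?_ hbound
  filter_upwards [hlim.eventually_gt_atTop 0] with j hRj
  refine intervalIntegral.norm_integral_le_of_norm_le_const fun σ hσ => ?_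
  rw [Set.uIoc_of_le (by linarith)] at hσ
  exact norm_perronIntegrand_le ha hx hRj hδ (hdist j) (Set.Ioc_subset_Icc_self hσ) (hτ j)

end HorizontalSegments

/-! ### The poles of the integrand -/

section Poles

variable {n b : ℕ} {a : Fin n → ℕ} {x : ℝ} {s p : ℂ} {μ ν : ℤ} {j k m l : Fin n}

/-- The zero `2πiν / log b` of `1 - b^{-s}`. -/
noncomputable def logPole (b : ℕ) (ν : ℤ) : ℂ := (2 * π * ν / Real.log b : ℝ) * I

lemma logPole_re (b : ℕ) (ν : ℤ) : (logPole b ν).re = 0 := by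
  rw [logPole, Complex.re_ofReal_mul, Complex.I_re, mul_zero]

lemma logPole_im (b : ℕ) (ν : ℤ) : (logPole b ν).im = 2 * π * ν / Real.log b := by
  rw [logPole, Complex.im_ofReal_mul, Complex.I_im, mul_one]

lemma logPole_zero (b : ℕ) : logPole b 0 = 0 := by simp [logPole]

lemma log_natCast_pos (hb : 1 < b) : 0 < Real.log b := Real.log_pos (mod_cast hb)

lemma logPole_mul_log (hb : 1 < b) (ν : ℤ) : logPole b ν * Real.log b = 2 * π * ν * I := by
  rw [logPole, mul_right_comm, ← Complex.ofReal_mul, div_mul_cancel₀ _ (log_natCast_pos hb).ne']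
  push_cast
  rfl

lemma logPole_injective (hb : 1 < b) : Function.Injective (logPole b) := fun μ ν h => by
  have him := congrArg Complex.im h
  rw [logPole_im, logPole_im, div_left_inj' (log_natCast_pos hb).ne'] at him
  exact_mod_cast mul_left_cancel₀ Real.two_pi_pos.ne' him

lemma logPole_ne_zero (hb : 1 < b) (hν : ν ≠ 0) : logPole b ν ≠ 0 :=
  logPole_zero b ▸ (logPole_injective hb).ne hν

lemma one_sub_one_div_cpow_eq_zero_iff (hb : 1 < b) :
    1 - 1 / (b : ℂ) ^ s = 0 ↔ ∃ ν : ℤ, s = logPole b ν := by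
  have hlog : (Real.log b : ℂ) ≠ 0 := Complex.ofReal_ne_zero.2 (log_natCast_pos hb).ne'
  rw [one_div_natCast_cpow (zero_lt_one.trans hb).ne', sub_eq_zero, eq_comm, Complex.exp_neg,
    inv_eq_one, Complex.exp_eq_one_iff]
  refine exists_congr fun ν => ?_
  rw [← mul_left_inj' hlog (a := s), logPole_mul_log hb]
  constructor <;> intro h <;> linear_combination h

lemma pow_natAbs_eq_of_int_mul_log_eq {b c : ℕ} (hb : 0 < b) (hc : 0 < c)
    (h : ν * Real.log b = μ * Real.log c) : b ^ ν.natAbs = c ^ μ.natAbs := by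
  have habs : (ν.natAbs : ℝ) * Real.log b = μ.natAbs * Real.log c := by
    have := congrArg abs h
    rwa [abs_mul, abs_mul, abs_of_nonneg (Real.log_natCast_nonneg b),
      abs_of_nonneg (Real.log_natCast_nonneg c), ← Int.cast_abs, ← Int.cast_abs,
      ← Nat.cast_natAbs, ← Nat.cast_natAbs] at this
  rw [← Real.log_pow, ← Real.log_pow] at habs
  exact_mod_cast Real.log_injOn_pos (Set.mem_Ioi.2 (by positivity))
    (Set.mem_Ioi.2 (by positivity)) habs

lemma eq_of_logPole_eq (hinj : Function.Injective (powerProduct a)) (hν : ν ≠ 0)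
    (h : logPole (a j) ν = logPole (a k) μ) : k = j := by
  have ha := one_lt_of_powerProduct_injective hinj
  have him := congrArg Complex.im h
  rw [logPole_im, logPole_im, div_eq_div_iff (log_natCast_pos (ha j)).ne'
    (log_natCast_pos (ha k)).ne', mul_assoc, mul_assoc (2 * π)] at him
  have hpow := pow_natAbs_eq_of_int_mul_log_eq (zero_lt_one.trans (ha k))
    (zero_lt_one.trans (ha j)) (mul_left_cancel₀ Real.two_pi_pos.ne' him)
  rw [← powerProduct_single, ← powerProduct_single] at hpow
  by_contra hkj
  have hentry := congrFun (hinj hpow) k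
  rw [Pi.single_eq_same, Pi.single_eq_of_ne hkj, Int.natAbs_eq_zero] at hentry
  exact hν hentry

lemma analyticAt_one_sub_one_div_cpow (hb : b ≠ 0) :
    AnalyticAt ℂ (fun s : ℂ => 1 - 1 / (b : ℂ) ^ s) p := by
  simp only [one_div_natCast_cpow hb]
  fun_prop

lemma deriv_one_sub_one_div_cpow_logPole (hb : 1 < b) (ν : ℤ) :
    deriv (fun s : ℂ => 1 - 1 / (b : ℂ) ^ s) (logPole b ν) = Real.log b := by
  have hone := (one_sub_one_div_cpow_eq_zero_iff hb).2 ⟨ν, rfl⟩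
  simp only [one_div_natCast_cpow (zero_lt_one.trans hb).ne'] at hone ⊢
  have hlin : HasDerivAt (fun s : ℂ => -(Real.log b * s)) (-(Real.log b : ℂ)) (logPole b ν) := by
    simpa using ((hasDerivAt_id (logPole b ν)).const_mul (Real.log b : ℂ)).fun_neg
  rw [(hlin.cexp.const_sub 1).deriv, ← sub_eq_zero.1 hone]
  ring

lemma analyticAt_mul_prod_one_sub (ha : ∀ k, a k ≠ 0) (S : Finset (Fin n)) :
    AnalyticAt ℂ (fun s : ℂ => s * ∏ k ∈ S, (1 - 1 / (a k : ℂ) ^ s)) p :=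
  analyticAt_id.mul (Finset.analyticAt_fun_prod S fun k _ => analyticAt_one_sub_one_div_cpow (ha k))

lemma meromorphicAt_perronIntegrand (ha : ∀ k, a k ≠ 0) (hx : 0 < x) :
    MeromorphicAt (perronIntegrand a x) p :=
  (analyticAt_const_cpow hx).meromorphicAt.div (analyticAt_mul_prod_one_sub ha _).meromorphicAt

lemma differentiableAt_perronIntegrand (ha : ∀ k, 1 < a k) (hx : 0 < x) (hs : s ≠ 0)
    (hpole : ∀ k, ∀ ν : ℤ, s ≠ logPole (a k) ν) :
    DifferentiableAt ℂ (perronIntegrand a x) s :=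
  (analyticAt_const_cpow hx).differentiableAt.div
    (analyticAt_mul_prod_one_sub (fun k => (zero_lt_one.trans (ha k)).ne') _).differentiableAt
    (mul_ne_zero hs (Finset.prod_ne_zero_iff.2 fun k _ hk =>
      let ⟨ν, hν⟩ := (one_sub_one_div_cpow_eq_zero_iff (ha k)).1 hk
      hpole k ν hν))

lemma one_sub_one_div_cpow_logPole_ne_zero (hinj : Function.Injective (powerProduct a))
    (hlm : l ≠ m) (hν : ν ≠ 0) : 1 - 1 / (a l : ℂ) ^ logPole (a m) ν ≠ 0 := fun h =>
  let ⟨_, hμ⟩ := (one_sub_one_div_cpow_eq_zero_iff (one_lt_of_powerProduct_injective hinj l)).1 h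
  hlm (eq_of_logPole_eq hinj hν hμ)

lemma residue_perronIntegrand_logPole (hinj : Function.Injective (powerProduct a)) (hx : 0 < x)
    (m : Fin n) (hν : ν ≠ 0) :
    residue (perronIntegrand a x) (logPole (a m) ν) =
      (x : ℂ) ^ logPole (a m) ν / (2 * π * ν * I) *
        ∏ l ∈ Finset.univ.erase m, (1 - 1 / (a l : ℂ) ^ logPole (a m) ν)⁻¹ := by
  have ha := one_lt_of_powerProduct_injective hinj
  have ha0 (k : Fin n) : a k ≠ 0 := (zero_lt_one.trans (ha k)).ne'
  set p := logPole (a m) ν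
  have hsplit : perronIntegrand a x = fun s =>
      (x : ℂ) ^ s / (s * ∏ l ∈ Finset.univ.erase m, (1 - 1 / (a l : ℂ) ^ s)) /
        (1 - 1 / (a m : ℂ) ^ s) := by
    funext s
    rw [perronIntegrand, ← Finset.prod_erase_mul _ _ (Finset.mem_univ m), ← mul_assoc,
      div_mul_eq_div_div]
  have hne : p * ∏ l ∈ Finset.univ.erase m, (1 - 1 / (a l : ℂ) ^ p) ≠ 0 :=
    mul_ne_zero (logPole_ne_zero (ha m) hν) (Finset.prod_ne_zero_iff.2 fun l hl =>
      one_sub_one_div_cpow_logPole_ne_zero hinj (Finset.ne_of_mem_erase hl) hν)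
  have hderiv := deriv_one_sub_one_div_cpow_logPole (ha m) ν
  rw [hsplit, residue_div_of_deriv_ne_zero
    ((analyticAt_const_cpow hx).fun_div (analyticAt_mul_prod_one_sub ha0 _) hne)
    (analyticAt_one_sub_one_div_cpow (ha0 m))
    ((one_sub_one_div_cpow_eq_zero_iff (ha m)).2 ⟨ν, rfl⟩)
    (hderiv ▸ Complex.ofReal_ne_zero.2 (log_natCast_pos (ha m)).ne'), hderiv,
    ← logPole_mul_log (ha m), Finset.prod_inv_distrib, div_div, mul_right_comm, div_mul_eq_div_div,
    div_eq_mul_inv (_ / _)]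

end Poles

/-! ### The residues in terms of cotangents -/

section Cotangents

variable {n : ℕ} {a : Fin n → ℕ} {x θ : ℝ} {ν : ℤ}

lemma cot_neg (θ : ℝ) : Real.cot (-θ) = -Real.cot θ := by
  rw [Real.cot_eq_cos_div_sin, Real.cot_eq_cos_div_sin, Real.cos_neg, Real.sin_neg, div_neg]

lemma inv_one_sub_exp_neg (h : 1 - Complex.exp (-(2 * I * θ)) ≠ 0) :
    (1 - Complex.exp (-(2 * I * θ)))⁻¹ = 1 / 2 * (1 + -I * Real.cot θ) := by
  rw [Complex.ofReal_cot, Complex.cot_eq_exp_ratio]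
  rw [Complex.exp_neg] at h ⊢
  have hexp := Complex.exp_ne_zero (2 * I * θ)
  generalize Complex.exp (2 * I * θ) = w at h hexp ⊢
  have hw : w - 1 ≠ 0 := by
    rintro hw
    simp [sub_eq_zero.1 hw] at h
  have hw' : 1 - w ≠ 0 := by rwa [← neg_sub, neg_ne_zero]
  field_simp
  ring

/-- The part of the residue at `2πiν / log a_m` that belongs to the index set `S`, up to the
factor `2^{1 - n}`. -/
noncomputable def residueTerm (a : Fin n → ℕ) (x : ℝ) (m : Fin n) (S : Finset (Fin n)) (ν : ℤ) :
    ℂ :=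
  Complex.exp ((2 * π * ν * (Real.log x / Real.log (a m)) : ℝ) * I) / (2 * π * ν * I) *
    ∏ l ∈ S, (-I * Real.cot (π * ν * Real.log (a l) / Real.log (a m)))

lemma residue_perronIntegrand_eq_sum_residueTerm (hinj : Function.Injective (powerProduct a))
    (hx : 0 < x) (m : Fin n) (hν : ν ≠ 0) :
    residue (perronIntegrand a x) (logPole (a m) ν) =
      (1 / 2) ^ (n - 1) * ∑ S ∈ (Finset.univ.erase m).powerset, residueTerm a x m S ν := by
  have ha := one_lt_of_powerProduct_injective hinj
  have hpow : (x : ℂ) ^ logPole (a m) ν =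
      Complex.exp ((2 * π * ν * (Real.log x / Real.log (a m)) : ℝ) * I) := by
    rw [Complex.cpow_def_of_ne_zero (Complex.ofReal_ne_zero.2 hx.ne'), ← Complex.ofReal_log hx.le,
      logPole]
    congr 1
    push_cast
    ring
  have hfactor (l : Fin n) (hl : l ∈ Finset.univ.erase m) :
      (1 - 1 / (a l : ℂ) ^ logPole (a m) ν)⁻¹ =
        1 / 2 * (1 + -I * Real.cot (π * ν * Real.log (a l) / Real.log (a m))) := by
    have hne := one_sub_one_div_cpow_logPole_ne_zero hinj (Finset.ne_of_mem_erase hl) hν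
    have hexp : 1 / (a l : ℂ) ^ logPole (a m) ν =
        Complex.exp (-(2 * I * (π * ν * Real.log (a l) / Real.log (a m) : ℝ))) := by
      rw [one_div_natCast_cpow (zero_lt_one.trans (ha l)).ne', logPole]
      congr 2
      push_cast
      ring
    rw [hexp] at hne ⊢
    exact inv_one_sub_exp_neg hne
  rw [residue_perronIntegrand_logPole hinj hx m hν, hpow, Finset.prod_congr rfl hfactor,
    Finset.prod_mul_distrib, Finset.prod_const, Finset.card_erase_of_mem (Finset.mem_univ m),
    Finset.card_univ, Fintype.card_fin, Finset.prod_one_add, mul_left_comm, Finset.mul_sum]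
  rfl

lemma residueTerm_neg (a : Fin n → ℕ) (x : ℝ) (m : Fin n) (S : Finset (Fin n)) (ν : ℤ) :
    residueTerm a x m S (-ν) = (starRingEnd ℂ) (residueTerm a x m S ν) := by
  have hcot (l : Fin n) : Real.cot (π * (-ν : ℤ) * Real.log (a l) / Real.log (a m)) =
      -Real.cot (π * ν * Real.log (a l) / Real.log (a m)) := by
    rw [← cot_neg]
    congr 1
    push_cast
    ring
  simp only [residueTerm, hcot]
  simp only [map_mul, map_div₀, map_prod, map_neg, map_ofNat, map_intCast, ← Complex.exp_conj,
    Complex.conj_ofReal, Complex.conj_I, Int.cast_neg, mul_neg, neg_mul, neg_neg,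
    Complex.ofReal_neg]

lemma neg_I_pow (r : ℕ) : (-I) ^ r = Complex.exp (-(π * r / 2 : ℝ) * I) := by
  have hI : -I = Complex.exp (-(π / 2 * I)) := by
    rw [Complex.exp_neg, Complex.exp_pi_div_two_mul_I, Complex.inv_I]
  rw [hI, ← Complex.exp_nat_mul]
  congr 1
  push_cast
  ring

lemma residueTerm_natCast_re (a : Fin n → ℕ) (x : ℝ) (m : Fin n) (S : Finset (Fin n)) (k : ℕ) :
    (residueTerm a x m S k).re = cotangentTerm a x m S k / (2 * π) := by
  set φ : ℝ := 2 * π * k * (Real.log x / Real.log (a m))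
  set C : ℝ := ∏ l ∈ S, Real.cot (π * k * Real.log (a l) / Real.log (a m))
  have hterm : residueTerm a x m S k =
      (C / (2 * π * k) : ℝ) * (Complex.exp ((φ - π * S.card / 2 : ℝ) * I) * -I) := by
    have hexp : Complex.exp ((φ - π * S.card / 2 : ℝ) * I) =
        Complex.exp (φ * I) * (-I) ^ S.card := by
      rw [neg_I_pow, ← Complex.exp_add]
      congr 1
      push_cast
      ring
    rw [hexp, residueTerm, Finset.prod_mul_distrib, Finset.prod_const, ← Complex.ofReal_prod,
      Int.cast_natCast, Int.cast_natCast, ← div_div, Complex.div_I]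
    change -(Complex.exp (φ * I) / (2 * π * k) * I) * ((-I) ^ S.card * (C : ℂ)) = _
    clear_value φ C
    push_cast
    ring
  rw [hterm, Complex.re_ofReal_mul, mul_neg, Complex.neg_re, Complex.mul_I_re, neg_neg,
    Complex.exp_ofReal_mul_I_im, cotangentTerm]
  ring

lemma residueTerm_add_residueTerm_neg (a : Fin n → ℕ) (x : ℝ) (m : Fin n) (S : Finset (Fin n))
    (k : ℕ) :
    residueTerm a x m S k + residueTerm a x m S (-k) = (cotangentTerm a x m S k / π : ℝ) := by
  rw [residueTerm_neg, Complex.add_conj, residueTerm_natCast_re]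
  congr 1
  field_simp

lemma residue_perronIntegrand_add_neg (hinj : Function.Injective (powerProduct a))
    (hx : 0 < x) (m : Fin n) {k : ℕ} (hk : k ≠ 0) :
    residue (perronIntegrand a x) (logPole (a m) k) +
        residue (perronIntegrand a x) (logPole (a m) (-k)) =
      (1 / (2 ^ (n - 1) * π) * ∑ S ∈ (Finset.univ.erase m).powerset,
        cotangentTerm a x m S k : ℝ) := by
  rw [residue_perronIntegrand_eq_sum_residueTerm hinj hx m (Nat.cast_ne_zero.2 hk),
    residue_perronIntegrand_eq_sum_residueTerm hinj hx m (neg_ne_zero.2 (Nat.cast_ne_zero.2 hk)),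
    ← mul_add, ← Finset.sum_add_distrib]
  simp only [residueTerm_add_residueTerm_neg, ← Complex.ofReal_sum, ← Finset.sum_div]
  push_cast
  rw [one_div_pow]
  ring

end Cotangents

/-! ### The sum of the residues -/

section SumOfResidues

variable {n b : ℕ} {a : Fin n → ℕ} {x c R : ℝ} {ν : ℤ}

lemma sum_Icc_neg_erase_zero {M : Type*} [AddCommMonoid M] (K : ℕ) (f : ℤ → M) :
    ∑ ν ∈ (Finset.Icc (-(K : ℤ)) K).erase 0, f ν = ∑ k ∈ Finset.Icc 1 K, (f k + f (-k)) := by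
  induction K with
  | zero => simp
  | succ K ih =>
    have hIcc : (Finset.Icc (-((K + 1 : ℕ) : ℤ)) (K + 1 : ℕ)).erase 0 =
        insert ((K + 1 : ℕ) : ℤ)
          (insert (-((K + 1 : ℕ) : ℤ)) ((Finset.Icc (-(K : ℤ)) K).erase 0)) := by
      ext ν
      simp only [Finset.mem_erase, Finset.mem_Icc, Finset.mem_insert]
      omega
    rw [hIcc, Finset.sum_insert (by simp; omega), Finset.sum_insert (by simp), ih,
      Finset.sum_Icc_succ_top (by omega), ← add_assoc, add_comm]

/-- The indices `(m, ν)` of the poles `2πiν / log a_m ≠ 0` between the lines `Im s = ±2πR`. -/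
noncomputable def poleIndices (a : Fin n → ℕ) (R : ℝ) : Finset (Σ _ : Fin n, ℤ) :=
  Finset.univ.sigma fun m =>
    (Finset.Icc (-(⌊R * Real.log (a m)⌋₊ : ℤ)) ⌊R * Real.log (a m)⌋₊).erase 0

lemma mem_poleIndices {q : Σ _ : Fin n, ℤ} :
    q ∈ poleIndices a R ↔ q.2 ≠ 0 ∧ |(q.2 : ℝ)| ≤ R * Real.log (a q.1) := by
  simp only [poleIndices, Finset.mem_sigma, Finset.mem_univ, true_and, Finset.mem_erase]
  refine and_congr_right fun hν => ?_
  rw [Finset.mem_Icc, ← abs_le, Int.abs_eq_natAbs, Nat.cast_le,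
    Nat.le_floor_iff' (Int.natAbs_ne_zero.2 hν), Nat.cast_natAbs, Int.cast_abs]

lemma logPole_injOn_poleIndices (hinj : Function.Injective (powerProduct a)) (R : ℝ) :
    Set.InjOn (fun q : Σ _ : Fin n, ℤ => logPole (a q.1) q.2) (poleIndices a R) := by
  rintro ⟨j, μ⟩ hq ⟨k, ν⟩ - h
  obtain rfl := eq_of_logPole_eq hinj (mem_poleIndices.1 hq).1 h
  exact congrArg _ (logPole_injective (one_lt_of_powerProduct_injective hinj _) h)

lemma logPole_mem_openRect_iff (hb : 1 < b) (hc : 0 < c) :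
    logPole b ν ∈ openRect ⟨-c, -(2 * π * R)⟩ ⟨c, 2 * π * R⟩ ↔ |(ν : ℝ)| < R * Real.log b := by
  have hlog := log_natCast_pos hb
  change (-c < (logPole b ν).re ∧ (logPole b ν).re < c) ∧
    -(2 * π * R) < (logPole b ν).im ∧ (logPole b ν).im < 2 * π * R ↔ _
  rw [logPole_re, logPole_im, and_iff_right (And.intro (neg_lt_zero.2 hc) hc), ← abs_lt, abs_div,
    abs_of_pos hlog, div_lt_iff₀ hlog, abs_mul, abs_of_pos Real.two_pi_pos, mul_assoc (2 * π),
    mul_lt_mul_iff_right₀ Real.two_pi_pos]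

lemma logPole_mem_closedRect_iff (hb : 1 < b) (hc : 0 ≤ c) :
    logPole b ν ∈ closedRect ⟨-c, -(2 * π * R)⟩ ⟨c, 2 * π * R⟩ ↔ |(ν : ℝ)| ≤ R * Real.log b := by
  have hlog := log_natCast_pos hb
  change (-c ≤ (logPole b ν).re ∧ (logPole b ν).re ≤ c) ∧
    -(2 * π * R) ≤ (logPole b ν).im ∧ (logPole b ν).im ≤ 2 * π * R ↔ _
  rw [logPole_re, logPole_im, and_iff_right (And.intro (neg_nonpos.2 hc) hc), ← abs_le, abs_div,
    abs_of_pos hlog, div_le_iff₀ hlog, abs_mul, abs_of_pos Real.two_pi_pos, mul_assoc (2 * π),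
    mul_le_mul_iff_right₀ Real.two_pi_pos]

/-- The terms that belong to the empty index set, which `cotangentSum` leaves out. -/
noncomputable def sineSum (a : Fin n → ℕ) (x R : ℝ) : ℝ :=
  ∑ m, ∑ k ∈ Finset.Icc 1 ⌊R * Real.log (a m)⌋₊,
    Real.sin (2 * π * k * (Real.log x / Real.log (a m))) / k

lemma sineSum_add_cotangentSum (a : Fin n → ℕ) (x R : ℝ) :
    sineSum a x R + cotangentSum a x R =
      ∑ m, ∑ k ∈ Finset.Icc 1 ⌊R * Real.log (a m)⌋₊,
        ∑ S ∈ (Finset.univ.erase m).powerset, cotangentTerm a x m S k := by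
  rw [sineSum, cotangentSum, ← Finset.sum_add_distrib]
  refine Finset.sum_congr rfl fun m _ => ?_
  rw [Finset.sum_comm (t := (Finset.univ.erase m).powerset), Finset.sum_powerset,
    Finset.card_erase_of_mem (Finset.mem_univ m), Finset.card_univ, Fintype.card_fin,
    Finset.range_eq_Ico, Finset.sum_eq_sum_Ico_succ_bot (Nat.succ_pos _)]
  congr 1
  simp [cotangentTerm]

lemma sum_residue_poleIndices (hinj : Function.Injective (powerProduct a)) (hx : 0 < x) (R : ℝ) :
    ∑ q ∈ poleIndices a R, residue (perronIntegrand a x) (logPole (a q.1) q.2) =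
      (1 / (2 ^ (n - 1) * π) * (sineSum a x R + cotangentSum a x R) : ℝ) := by
  simp only [poleIndices, Finset.sum_sigma, sum_Icc_neg_erase_zero, sineSum_add_cotangentSum,
    Finset.mul_sum _ _ (1 / (2 ^ (n - 1) * π)), Complex.ofReal_sum]
  refine Finset.sum_congr rfl fun m _ => Finset.sum_congr rfl fun k hk => ?_
  have hk0 : k ≠ 0 := Nat.one_le_iff_ne_zero.1 (Finset.mem_Icc.1 hk).1
  rw [residue_perronIntegrand_add_neg hinj hx m hk0, Finset.mul_sum, Complex.ofReal_sum]

lemma rectIntegral_perronIntegrand (hinj : Function.Injective (powerProduct a)) (hx : 0 < x)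
    (hc : 0 < c) (hR : 0 < R) (hcut : ∀ k, ∀ ν : ℤ, R * Real.log (a k) ≠ ν) :
    rectIntegral (perronIntegrand a x) ⟨-c, -(2 * π * R)⟩ ⟨c, 2 * π * R⟩ =
      2 * π * I * (residue (perronIntegrand a x) 0 +
        (1 / (2 ^ (n - 1) * π) * (sineSum a x R + cotangentSum a x R) : ℝ)) := by
  have ha := one_lt_of_powerProduct_injective hinj
  have hT : 0 < 2 * π * R := by positivity
  set P := (poleIndices a R).image fun q => logPole (a q.1) q.2
  have hzero : (0 : ℂ) ∉ P := fun h => by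
    obtain ⟨q, hq, hq0⟩ := Finset.mem_image.1 h
    exact logPole_ne_zero (ha q.1) (mem_poleIndices.1 hq).1 hq0
  rw [rectIntegral_eq_sum_residue (by simp; linarith) (by simp; linarith) (insert 0 P) ?_ ?_
    fun p _ => meromorphicAt_perronIntegrand (fun k => (zero_lt_one.trans (ha k)).ne') hx,
    Finset.sum_insert hzero, Finset.sum_image (logPole_injOn_poleIndices hinj R),
    sum_residue_poleIndices hinj hx]
  · intro p hp
    obtain rfl | hp := Finset.mem_insert.1 hp
    · simp [openRect, Complex.mem_reProdIm, hc, hT]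
    · obtain ⟨q, hq, rfl⟩ := Finset.mem_image.1 hp
      refine (logPole_mem_openRect_iff (ha q.1) hc).2
        ((mem_poleIndices.1 hq).2.lt_of_ne fun h => ?_)
      exact hcut q.1 |q.2| (by rw [← h, Int.cast_abs])
  · intro s hs hsP
    rw [Finset.mem_insert, not_or] at hsP
    refine differentiableAt_perronIntegrand ha hx hsP.1 fun m ν hsν => hsP.2 ?_
    subst hsν
    have hν : ν ≠ 0 := by
      rintro rfl
      exact hsP.1 (logPole_zero _)
    exact Finset.mem_image.2 ⟨⟨m, ν⟩,
      mem_poleIndices.2 ⟨hν, (logPole_mem_closedRect_iff (ha m) hc.le).1 hs⟩, rfl⟩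

end SumOfResidues

/-! ### The Fourier series of the sawtooth function -/

section Sawtooth

variable {z : ℂ} {y : ℝ}

-- The partial sums of `∑ z ^ k` are bounded, so Dirichlet's test applies.
lemma exists_tendsto_sum_pow_div (hz : ‖z‖ ≤ 1) (hz1 : z ≠ 1) :
    ∃ l, Tendsto (fun K : ℕ => ∑ k ∈ Finset.range K, z ^ k / k) atTop (𝓝 l) := by
  have hanti : Antitone fun i : ℕ => 1 / ((i : ℝ) + 1) := fun i j hij =>
    one_div_le_one_div_of_le (by positivity) (by gcongr)
  have hbound (K : ℕ) : ‖∑ i ∈ Finset.range K, z ^ (i + 1)‖ ≤ 2 / ‖z - 1‖ := by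
    have hK : ‖z ^ K - 1‖ ≤ 2 :=
      (norm_sub_le _ _).trans (by
        rw [norm_pow, norm_one, ← one_add_one_eq_two]
        gcongr
        exact pow_le_one₀ (norm_nonneg z) hz)
    simp only [pow_succ']
    rw [← Finset.mul_sum, geom_sum_eq hz1, norm_mul, norm_div]
    exact (mul_le_of_le_one_left (by positivity) hz).trans (by gcongr)
  obtain ⟨l, hl⟩ := cauchySeq_tendsto_of_complete
    (hanti.cauchySeq_series_mul_of_tendsto_zero_of_bounded
      tendsto_one_div_add_atTop_nhds_zero_nat hbound)
  refine ⟨l, (tendsto_add_atTop_iff_nat 1).1 (hl.congr fun K => ?_)⟩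
  rw [Finset.sum_range_succ', Nat.cast_zero, div_zero, add_zero]
  refine Finset.sum_congr rfl fun i _ => ?_
  rw [Complex.real_smul, one_div, Complex.ofReal_inv, ← div_eq_inv_mul]
  push_cast
  rfl

lemma one_sub_mem_slitPlane (hz : ‖z‖ ≤ 1) (hz1 : z ≠ 1) : 1 - z ∈ Complex.slitPlane := by
  have hre : z.re ≠ 1 := fun h => by
    have him : z.im = 0 := Complex.abs_re_eq_norm.1
      (le_antisymm (Complex.abs_re_le_norm z) (by rwa [h, abs_one]))
    exact hz1 (Complex.ext h him)
  exact Or.inl (by simpa using ((Complex.re_le_norm z).trans hz).lt_of_ne hre)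

-- Abel's limit theorem identifies the sum.
lemma tendsto_sum_pow_div (hz : ‖z‖ ≤ 1) (hz1 : z ≠ 1) :
    Tendsto (fun K : ℕ => ∑ k ∈ Finset.range K, z ^ k / k) atTop (𝓝 (-Complex.log (1 - z))) := by
  obtain ⟨l, hl⟩ := exists_tendsto_sum_pow_div hz hz1
  have hcont : ContinuousAt (fun r : ℝ => -Complex.log (1 - z * r)) 1 :=
    (ContinuousAt.clog (by fun_prop) (by simpa using one_sub_mem_slitPlane hz hz1)).neg
  have hlog : Tendsto (fun r : ℝ => -Complex.log (1 - z * r)) (𝓝[<] 1)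
      (𝓝 (-Complex.log (1 - z))) := by
    simpa using hcont.tendsto.mono_left nhdsWithin_le_nhds
  have habel := tendsto_map'_iff.1 (Complex.tendsto_tsum_powerSeries_nhdsWithin_lt hl)
  suffices l = -Complex.log (1 - z) from this ▸ hl
  refine tendsto_nhds_unique habel (hlog.congr' ?_)
  filter_upwards [Ioo_mem_nhdsLT (zero_lt_one' ℝ)] with r ⟨hr0, hr1⟩
  have hzr : ‖z * r‖ < 1 := by
    rw [norm_mul, Complex.norm_real, Real.norm_of_nonneg hr0.le]
    exact (mul_le_of_le_one_left hr0.le hz).trans_lt hr1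
  rw [← (Complex.hasSum_taylorSeries_neg_log hzr).tsum_eq]
  refine tsum_congr fun k => ?_
  rw [mul_pow, mul_div_right_comm]

lemma one_sub_exp_two_pi_mul (y : ℝ) :
    1 - Complex.exp ((2 * π * y : ℝ) * I) =
      (2 * Real.sin (π * y) : ℝ) * Complex.exp ((π * (y - 1 / 2) : ℝ) * I) := by
  have hdouble : Complex.exp ((2 * π * y : ℝ) * I) =
      Complex.exp ((π * y : ℝ) * I) * Complex.exp ((π * y : ℝ) * I) := by
    rw [← Complex.exp_add]
    congr 1
    push_cast
    ring
  have hshift : Complex.exp ((π * (y - 1 / 2) : ℝ) * I) =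
      Complex.exp ((π * y : ℝ) * I) * -I := by
    rw [← Complex.exp_neg_pi_div_two_mul_I, ← Complex.exp_add]
    congr 1
    push_cast
    ring
  have hinv : Complex.exp (-(π * y : ℝ) * I) * Complex.exp ((π * y : ℝ) * I) = 1 := by
    rw [← Complex.exp_add, neg_mul, neg_add_cancel, Complex.exp_zero]
  rw [hdouble, hshift]
  push_cast at hinv ⊢
  rw [Complex.sin]
  linear_combination -hinv + (Complex.exp (-(π * y) * I) * Complex.exp (π * y * I) -
    Complex.exp (π * y * I) ^ 2) * Complex.I_sq

lemma sin_pi_mul_pos (hy0 : 0 < y) (hy1 : y < 1) : 0 < Real.sin (π * y) :=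
  Real.sin_pos_of_pos_of_lt_pi (by positivity) (mul_lt_of_lt_one_right Real.pi_pos hy1)

lemma arg_one_sub_exp_two_pi_mul (hy0 : 0 < y) (hy1 : y < 1) :
    Complex.arg (1 - Complex.exp ((2 * π * y : ℝ) * I)) = π * (y - 1 / 2) := by
  have hsin := sin_pi_mul_pos hy0 hy1
  rw [one_sub_exp_two_pi_mul, Complex.exp_mul_I, Complex.arg_mul_cos_add_sin_mul_I (by positivity)]
  constructor <;> nlinarith [Real.pi_pos]

lemma tendsto_sum_sin_div_of_mem_Ioo (hy0 : 0 < y) (hy1 : y < 1) :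
    Tendsto (fun K : ℕ => ∑ k ∈ Finset.Icc 1 K, Real.sin (2 * π * k * y) / k) atTop
      (𝓝 (-(π * (y - 1 / 2)))) := by
  have harg := arg_one_sub_exp_two_pi_mul hy0 hy1
  set z := Complex.exp ((2 * π * y : ℝ) * I) with hz
  have hz1 : z ≠ 1 := fun h => by
    have hzero := one_sub_exp_two_pi_mul y
    rw [← hz, h, sub_self, eq_comm, mul_eq_zero, Complex.ofReal_eq_zero] at hzero
    exact hzero.elim (mul_pos two_pos (sin_pi_mul_pos hy0 hy1)).ne' (Complex.exp_ne_zero _)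
  have hlim := (Complex.continuous_im.tendsto _).comp ((tendsto_add_atTop_iff_nat 1).2
    (tendsto_sum_pow_div (Complex.norm_exp_ofReal_mul_I _).le hz1))
  rw [Complex.neg_im, Complex.log_im, harg] at hlim
  refine hlim.congr fun K => ?_
  rw [Function.comp_apply, Finset.range_eq_Ico, Finset.sum_eq_sum_Ico_succ_bot (Nat.succ_pos K),
    Nat.cast_zero, div_zero, zero_add, Complex.im_sum]
  refine Finset.sum_congr rfl fun k _ => ?_
  have hpow : z ^ k = Complex.exp ((2 * π * k * y : ℝ) * I) := by
    rw [hz, ← Complex.exp_nat_mul]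
    congr 1
    push_cast
    ring
  rw [hpow, ← Complex.ofReal_natCast, Complex.div_ofReal_im, Complex.exp_ofReal_mul_I_im]

lemma sin_two_pi_mul_fract (k : ℕ) (y : ℝ) :
    Real.sin (2 * π * k * Int.fract y) = Real.sin (2 * π * k * y) := by
  rw [← Real.sin_sub_int_mul_two_pi (2 * π * k * y) (k * ⌊y⌋), Int.fract]
  congr 1
  push_cast
  ring

lemma tendsto_sum_sin_div (y : ℝ) :
    Tendsto (fun K : ℕ => ∑ k ∈ Finset.Icc 1 K, Real.sin (2 * π * k * y) / k) atTop
      (𝓝 (-(π * bernoulliStar y))) := by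
  simp only [bernoulliStar, ← Int.fract_eq_zero_iff, ← sin_two_pi_mul_fract _ y]
  split_ifs with hy
  · simp [hy]
  · exact tendsto_sum_sin_div_of_mem_Ioo ((Int.fract_nonneg y).lt_of_ne' hy) (Int.fract_lt_one y)

end Sawtooth

/-! ### Existence of appropriate cutoffs -/

section Cutoffs

variable {n : ℕ} {δ t : ℝ}

-- Pigeonhole: the fractional parts of `(m c_1, …, m c_n)` accumulate, and differences of nearby
-- ones are close to integer vectors.
lemma exists_nat_mul_near_int (c : Fin n → ℝ) (hδ : 0 < δ) :
    ∃ H : ℕ → ℕ, Tendsto H atTop atTop ∧ ∀ j k, ∃ ν : ℤ, |H j * c k - ν| < δ := by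
  have hmem (m : ℕ) : (fun k => Int.fract (m * c k)) ∈ Set.Icc (0 : Fin n → ℝ) 1 :=
    ⟨fun k => Int.fract_nonneg _, fun k => (Int.fract_lt_one _).le⟩
  obtain ⟨l, -, φ, hφ, hl⟩ := isCompact_Icc.tendsto_subseq hmem
  obtain ⟨J, hJ⟩ := Metric.cauchySeq_iff'.1 hl.cauchySeq δ hδ
  refine ⟨fun j => φ (j + J) - φ J, (tendsto_sub_atTop_nat (φ J)).comp
    (hφ.tendsto_atTop.comp (tendsto_add_atTop_nat J)), fun j k =>
      ⟨⌊φ (j + J) * c k⌋ - ⌊φ J * c k⌋, ?_⟩⟩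
  have hfract : ((φ (j + J) - φ J : ℕ) : ℝ) * c k -
      ((⌊φ (j + J) * c k⌋ - ⌊φ J * c k⌋ : ℤ) : ℝ) =
        Int.fract (φ (j + J) * c k) - Int.fract (φ J * c k) := by
    rw [Nat.cast_sub (hφ.monotone (Nat.le_add_left J j)), Int.fract, Int.fract]
    push_cast
    ring
  rw [hfract]
  exact (dist_le_pi_dist _ _ k).trans_lt (hJ (j + J) (Nat.le_add_left J j))

lemma le_abs_sub_intCast (hδt : δ ≤ t) (htδ : t ≤ 1 - δ) (ν : ℤ) : δ ≤ |t - ν| := by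
  obtain hν | hν := le_or_gt ν 0
  · have : (ν : ℝ) ≤ 0 := mod_cast hν
    exact le_abs.2 (Or.inl (by linarith))
  · have : (1 : ℝ) ≤ ν := mod_cast hν
    exact le_abs.2 (Or.inr (by linarith))

-- If all the `H_j c_k` are near integers, then the `(H_j + t) c_k` stay away from them for a
-- small fixed shift `t > 0`.
lemma exists_tendsto_atTop_le_abs_mul_sub_int {c : Fin n → ℝ} (hc : ∀ k, 0 < c k) :
    ∃ R : ℕ → ℝ, Tendsto R atTop atTop ∧
      ∃ δ : ℝ, 0 < δ ∧ ∀ (j : ℕ) (k : Fin n) (ν : ℤ), δ ≤ |R j * c k - ν| := by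
  obtain ⟨t, ht, htc⟩ := Pi.exists_forall_pos_add_lt fun k => inv_pos.2 (mul_pos two_pos (hc k))
  obtain ⟨δ, hδ, hδc⟩ :=
    Pi.exists_forall_pos_add_lt fun k => half_pos (half_pos (mul_pos ht (hc k)))
  obtain ⟨H, hH, hnear⟩ := exists_nat_mul_near_int c hδ
  refine ⟨fun j => H j + t,
    tendsto_atTop_add_const_right _ _ (tendsto_natCast_atTop_atTop.comp hH), δ, hδ,
    fun j k ν => ?_⟩
  obtain ⟨μ, hμ⟩ := hnear j k
  have hlower : 2 * δ ≤ t * c k := by linarith [hδc k]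
  have hupper : t * c k ≤ 1 / 2 := by
    have := mul_le_mul_of_nonneg_right (htc k).le (hc k).le
    rwa [zero_add, mul_inv, mul_assoc, inv_mul_cancel₀ (hc k).ne', mul_one, ← one_div] at this
  have hfar := le_abs_sub_intCast hlower (by linarith) (ν - μ)
  have hsplit : (H j + t) * c k - ν = (t * c k - (ν - μ : ℤ)) - (-(H j * c k - μ)) := by
    push_cast
    ring
  have htri := abs_sub_abs_le_abs_sub (t * c k - (ν - μ : ℤ)) (-(H j * c k - μ))
  rw [abs_neg] at htri
  rw [hsplit]
  linarith

lemma exists_appropriateCutoffs {a : Fin n → ℕ} (ha : ∀ k, 1 < a k) :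
    ∃ R : ℕ → ℝ, AppropriateCutoffs a R :=
  exists_tendsto_atTop_le_abs_mul_sub_int fun k => log_natCast_pos (ha k)

end Cutoffs

/-! ### The counting formula -/

section CountingFormula

variable {n : ℕ} {a : Fin n → ℕ} {x : ℝ} {R : ℕ → ℝ}

lemma AppropriateCutoffs.tendsto_rectIntegral (hinj : Function.Injective (powerProduct a))
    (hx : 1 < x * ∏ k, (a k : ℝ)) (hR : AppropriateCutoffs a R) :
    Tendsto (fun j => (2 * π * I)⁻¹ *
        rectIntegral (perronIntegrand a x) ⟨-1, -(2 * π * R j)⟩ ⟨1, 2 * π * R j⟩) atTop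
      (𝓝 (countProducts a x - 1 / 2 * productChi a x : ℝ)) := by
  have hx0 : 0 < x := pos_of_mul_pos_left (zero_lt_one.trans hx) (by positivity)
  have ha (k : Fin n) : a k ≠ 0 := (zero_lt_one.trans (one_lt_of_powerProduct_injective hinj k)).ne'
  have hT : Tendsto (fun j => 2 * π * R j) atTop atTop := hR.1.const_mul_atTop Real.two_pi_pos
  have hvert := ((tendsto_verticalIntegral_perronIntegrand hinj hx0 one_pos).comp hT).sub
    ((tendsto_verticalIntegral_perronIntegrand_neg hinj hx one_pos).comp hT)
  have htop := hR.tendsto_integral_horizontal ha hx0 zero_le_one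
    (τ := fun j => 2 * π * R j) fun _ => rfl
  have hbot := hR.tendsto_integral_horizontal ha hx0 zero_le_one
    (τ := fun j => -(2 * π * R j)) fun _ => abs_neg _
  have hlim := hvert.sub ((htop.sub hbot).const_mul (2 * π * I)⁻¹)
  rw [sub_zero, sub_zero, mul_zero, sub_zero] at hlim
  refine hlim.congr fun j => ?_
  simp only [Function.comp_apply]
  rw [verticalIntegral_sub_verticalIntegral]
  ring

lemma AppropriateCutoffs.tendsto_sineSum (ha : ∀ k, 1 < a k) (hR : AppropriateCutoffs a R)
    (x : ℝ) :
    Tendsto (fun j => sineSum a x (R j)) atTop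
      (𝓝 (-(π * ∑ k, bernoulliStar (Real.log x / Real.log (a k))))) := by
  rw [Finset.mul_sum, ← Finset.sum_neg_distrib]
  exact tendsto_finsetSum _ fun k _ => (tendsto_sum_sin_div _).comp
    (tendsto_nat_floor_atTop.comp (hR.1.atTop_mul_const (log_natCast_pos (ha k))))

lemma AppropriateCutoffs.tendsto_cotangentSum (hinj : Function.Injective (powerProduct a))
    (hx : 1 < x * ∏ k, (a k : ℝ)) (hR : AppropriateCutoffs a R) :
    Tendsto (fun j => (cotangentSum a x (R j) : ℂ)) atTop
      (𝓝 (2 ^ (n - 1) * π * ((countProducts a x - 1 / 2 * productChi a x : ℝ) -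
          residue (perronIntegrand a x) 0) +
        (π * ∑ k, bernoulliStar (Real.log x / Real.log (a k)) : ℝ))) := by
  have hx0 : 0 < x := pos_of_mul_pos_left (zero_lt_one.trans hx) (by positivity)
  have hsine := (Complex.continuous_ofReal.tendsto _).comp
    (hR.tendsto_sineSum (one_lt_of_powerProduct_injective hinj) x)
  have hlim := (((hR.tendsto_rectIntegral hinj hx).sub_const
    (residue (perronIntegrand a x) 0)).const_mul (2 ^ (n - 1) * π : ℂ)).sub hsine
  rw [Complex.ofReal_neg, sub_neg_eq_add] at hlim
  refine hlim.congr' ?_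
  obtain ⟨hRtop, δ, hδ, hcut⟩ := hR
  filter_upwards [hRtop.eventually_gt_atTop 0] with j hj
  have hne (k : Fin n) (ν : ℤ) : R j * Real.log (a k) ≠ ν := fun h =>
    hδ.not_ge (by simpa [h] using hcut j k ν)
  have hπ : (π : ℂ) ≠ 0 := Complex.ofReal_ne_zero.2 Real.pi_ne_zero
  rw [rectIntegral_perronIntegrand hinj hx0 one_pos hj hne,
    inv_mul_cancel_left₀ Complex.two_pi_I_ne_zero, add_sub_cancel_left, Function.comp_apply]
  push_cast
  field_simp
  ring

end CountingFormula

theorem corollary13_general {n : ℕ} {a : Fin n → ℕ}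
    (hinj : Function.Injective (powerProduct a)) :
    (∃ R : ℕ → ℝ, AppropriateCutoffs a R) ∧
    ∀ x : ℝ, 1 < x * ∏ k, (a k : ℝ) →
      ∃ L : ℝ,
        (∀ R : ℕ → ℝ, AppropriateCutoffs a R →
          Tendsto (fun j => cotangentSum a x (R j)) atTop (𝓝 L)) ∧
        (countProducts a x : ℂ) =
          residue (perronIntegrand a x) 0
            - ((1 / 2 ^ (n - 1) * ∑ k, bernoulliStar (Real.log x / Real.log (a k)) : ℝ) : ℂ)
            + ((1 / (2 ^ (n - 1) * π) * L : ℝ) : ℂ)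
            + ((1 / 2 * productChi a x : ℝ) : ℂ) := by
  obtain ⟨R₀, hR₀⟩ := exists_appropriateCutoffs (one_lt_of_powerProduct_injective hinj)
  refine ⟨⟨R₀, hR₀⟩, fun x hx => ?_⟩
  have hclosed := Complex.isUniformEmbedding_ofReal.isClosedEmbedding.isClosed_range
  obtain ⟨L, hL⟩ := hclosed.mem_of_tendsto (hR₀.tendsto_cotangentSum hinj hx)
    (Eventually.of_forall fun j => Set.mem_range_self _)
  refine ⟨L, fun R hR => ?_, ?_⟩
  · rw [← tendsto_ofReal_iff, hL]
    exact hR.tendsto_cotangentSum hinj hx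
  · have hπ : (π : ℂ) ≠ 0 := Complex.ofReal_ne_zero.2 Real.pi_ne_zero
    rw [Complex.ofReal_mul _ L, hL]
    push_cast
    field_simp
    ring

/-! ### The first `n` primes -/

section FirstPrimes

variable {n : ℕ} {a : Fin n → ℕ}

lemma factorization_powerProduct (ha : ∀ k, (a k).Prime) (hinj : Function.Injective a)
    (q : Fin n → ℕ) (j : Fin n) : (powerProduct a q).factorization (a j) = q j := by
  rw [powerProduct, Nat.factorization_prod fun k _ => pow_ne_zero _ (ha k).ne_zero,
    Finsupp.finsetSum_apply, Finset.sum_eq_single j]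
  · rw [(ha j).factorization_pow, Finsupp.single_eq_same]
  · intro k _ hkj
    rw [(ha k).factorization_pow, Finsupp.single_eq_of_ne (hinj.ne hkj).symm]
  · simp

lemma powerProduct_injective (ha : ∀ k, (a k).Prime) (hinj : Function.Injective a) :
    Function.Injective (powerProduct a) := fun q q' h => by
  ext j
  rw [← factorization_powerProduct ha hinj q j, h, factorization_powerProduct ha hinj q' j]

lemma prime_firstPrimes (n : ℕ) (k : Fin n) : (firstPrimes n k).Prime := Nat.prime_nth_prime k

lemma firstPrimes_injective (n : ℕ) : Function.Injective (firstPrimes n) := fun _ _ h =>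
  Fin.ext (Nat.nth_injective Nat.infinite_setOfPred_prime h)

lemma one_lt_prod_natCast [NeZero n] (ha : ∀ k, 1 < a k) : 1 < ∏ k, (a k : ℝ) := by
  simpa using Finset.prod_lt_prod_of_nonempty (f := fun _ => (1 : ℝ)) (fun _ _ => one_pos)
    (fun k _ => Nat.one_lt_cast.2 (ha k)) Finset.univ_nonempty

end FirstPrimes

theorem corollary13 (n : ℕ) (hn : 1 ≤ n) :
    (∃ R : ℕ → ℝ, AppropriateCutoffs (firstPrimes n) R) ∧
    ∀ x : ℝ, 1 ≤ x →
      ∃ L : ℝ,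
        (∀ R : ℕ → ℝ, AppropriateCutoffs (firstPrimes n) R →
          Tendsto (fun j => cotangentSum (firstPrimes n) x (R j)) atTop (𝓝 L)) ∧
        (countProducts (firstPrimes n) x : ℂ) =
          residue (perronIntegrand (firstPrimes n) x) 0
            - ((1 / 2 ^ (n - 1) *
                ∑ k, bernoulliStar (Real.log x / Real.log (firstPrimes n k)) : ℝ) : ℂ)
            + ((1 / (2 ^ (n - 1) * Real.pi) * L : ℝ) : ℂ)
            + ((1 / 2 * productChi (firstPrimes n) x : ℝ) : ℂ) := by
  have hprime := prime_firstPrimes n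
  have : NeZero n := ⟨Nat.one_le_iff_ne_zero.1 hn⟩
  obtain ⟨hR, hL⟩ :=
    corollary13_general (powerProduct_injective hprime (firstPrimes_injective n))
  exact ⟨hR, fun x hx =>
    hL x (one_lt_mul_of_le_of_lt hx (one_lt_prod_natCast fun k => (hprime k).one_lt))⟩
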